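/- Consider primal-dual pairs of a covering LP (P): $\min c^{T}x$ s.t. $Ax\ge b$, $x\ge 0$, and a packing LP (D): $\max b^{T}y$ s.t. $A^{T}y\le c$, $y\ge 0$, where $A=(a_{ji})\in\mathbb{R}_{\ge 0}^{n_d\times n_p}$, $b\ge 0$, $c\ge 0$ and (P) is feasible. The network $G$ is the bipartite graph with a primal node for each variable $x_i$, a dual node for each variable $y_j$ (i.e. for each row of $A$), and an edge between primal node $i$ and dual node $j$ iff $a_{ji}\neq 0$; the nodes have unique identifiers from a totally ordered set. In the LOCAL model an algorithm *runs in $k$ rounds* if the output of each node is a function of its $k$-hop view: the nodes within distance $k$ with their identifiers, the coefficients $a_{ji}$ of the edges between them, and their inputs $b_j$, $c_i$ and random inputs. A vector $x$ (resp. $y$) is an *$\alpha$-approximation* for (P) (resp. (D)) if it is feasible and $c^{T}x\le\alpha\, c^{T}x'$ for all feasible $x'$ of (P) (resp. $b^{T}y'\le \alpha\, b^{T}y$ for all feasible $y'$ of (D)). The *LP algorithm* with parameters $\ell, R\in\mathbb{N}_{\ge1}$, $p\in[0,1]$ is the following. Let $\mathcal{G}$ be the graph on the dual nodes in which two distinct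 nodes are adjacent iff their distance in $G$ is at most $4$. Run $\ell$ independent instances $t=1,\dots,\ell$ of the Linial–Saks procedure on $\mathcal{G}$: each dual node $v$ draws independently a radius $r_v$ with $\Pr[r_v=s]=p^s(1-p)$ for $0\le s<R$ and $\Pr[r_v=R]=p^R$; each dual node $u$ takes as leader the node $v$ of highest identifier among those with $d_{\mathcal{G}}(u,v)\le r_v$, and $u$ is put into the cluster of $v$ iff $d_{\mathcal{G}}(u,v)<r_v$. For each cluster $K$ solve exactly, with an arbitrary exact LP solver, the sub-LP of (P) consisting of the inequalities $j\in K$ and the variables $x_i$ with $a_{ji}\ne0$ for some $j\in K$, and its dual; this gives values $x_{t,i}$, $y_{t,j}$ (and $0$ for variables that occur in no cluster). Put $x_i=\sum_t x_{t,i}$, $y_j=\sum_t y_{t,j}$. Output $x_i/\min_{j:\,a_{ji}\neq 0}\big((Ax)_j/b_j\big)$ at primal node $i$ (with $(Ax)_j/0=\infty$, $\min\emptyset=\infty$ and $x_i/\infty=0$) and $y_j/\ell$ at dual node $j$. **Statement.** (1) There are absolute constants $c,C>0$ and $k_0\in\mathbb{N}$ such that for all $\beta>0$, all integers $k\ge k_0$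 and $n\ge2$ there are parameters $\ell,R\ge 1$, $p\in[0,1]$ with which the LP algorithm runs in $k$ rounds and, on each pair (P), (D) as above with $n_d\le n$ (for instance $n=n_p+n_d$, the number of nodes of the network), computes $C\,n^{c/k}$-approximations for both (P) and (D) with probability at least $1-n^{-\beta}$. (2) There is an absolute constant $C>0$ such that for all $\beta>0$, all $\varepsilon\in(0,1)$ and all integers $n\ge 2$ there are parameters $\ell,R\ge1$, $p\in[0,1]$ with which the LP algorithm runs in at most $C\log(n)/\varepsilon$ rounds and, on each pair (P), (D) as above with $n_d\le n$, computes $(1+\varepsilon)$-approximations for both (P) and (D) with probability at least $1-n^{-\beta}$. -/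

import Mathlib

open MeasureTheory

/-- A primal-dual pair of a covering LP `min cᵀx, Ax ≥ b, x ≥ 0` and a packing LP
`max bᵀy, Aᵀy ≤ c, y ≥ 0`, laid out over a network. Network nodes are identified with their
identifiers: `Vp` is the set of identifiers of the primal nodes (one for each variable `x i`),
`Vd` that of the dual nodes (one for each variable `y j`, that is, for each row of `A`);
`A j i` is the entry in row `j` and column `i`. Only the entries with `j ∈ Vd`, `i ∈ Vp` have a
meaning; all definitions below ignore the others. -/
@[ext]
structure CoverPackLP (ID : Type*) where
  Vp : Finset ID
  Vd : Finset ID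
  A : ID → ID → ℝ
  b : ID → ℝ
  c : ID → ℝ
  A_nonneg : ∀ j i, 0 ≤ A j i
  b_nonneg : ∀ j, 0 ≤ b j
  c_nonneg : ∀ i, 0 ≤ c i

namespace CoverPackLP

variable {ID : Type*}

section LinearPrograms

/-- `(A x)_j`. -/
def rowValue (L : CoverPackLP ID) (x : ID → ℝ) (j : ID) : ℝ := ∑ i ∈ L.Vp, L.A j i * x i

/-- `(Aᵀ y)_i`. -/
def colValue (L : CoverPackLP ID) (y : ID → ℝ) (i : ID) : ℝ := ∑ j ∈ L.Vd, L.A j i * y j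

/-- `cᵀ x`. -/
def primalObj (L : CoverPackLP ID) (x : ID → ℝ) : ℝ := ∑ i ∈ L.Vp, L.c i * x i

/-- `bᵀ y`. -/
def dualObj (L : CoverPackLP ID) (y : ID → ℝ) : ℝ := ∑ j ∈ L.Vd, L.b j * y j

/-- `x` is feasible for the covering LP. -/
def PrimalFeasible (L : CoverPackLP ID) (x : ID → ℝ) : Prop :=
  (∀ i ∈ L.Vp, 0 ≤ x i) ∧ ∀ j ∈ L.Vd, L.b j ≤ L.rowValue x j

/-- `y` is feasible for the packing LP. -/
def DualFeasible (L : CoverPackLP ID) (y : ID → ℝ) : Prop :=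
  (∀ j ∈ L.Vd, 0 ≤ y j) ∧ ∀ i ∈ L.Vp, L.colValue y i ≤ L.c i

/-- `x` is an optimal solution of the covering LP. -/
def IsPrimalOptimal (L : CoverPackLP ID) (x : ID → ℝ) : Prop :=
  L.PrimalFeasible x ∧ ∀ x', L.PrimalFeasible x' → L.primalObj x ≤ L.primalObj x'

/-- `y` is an optimal solution of the packing LP. -/
def IsDualOptimal (L : CoverPackLP ID) (y : ID → ℝ) : Prop :=
  L.DualFeasible y ∧ ∀ y', L.DualFeasible y' → L.dualObj y' ≤ L.dualObj y

/-- `x` is an `α`-approximation for the covering LP. -/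
def IsPrimalApprox (L : CoverPackLP ID) (α : ℝ) (x : ID → ℝ) : Prop :=
  L.PrimalFeasible x ∧ ∀ x', L.PrimalFeasible x' → L.primalObj x ≤ α * L.primalObj x'

/-- `y` is an `α`-approximation for the packing LP. -/
def IsDualApprox (L : CoverPackLP ID) (α : ℝ) (y : ID → ℝ) : Prop :=
  L.DualFeasible y ∧ ∀ y', L.DualFeasible y' → L.dualObj y' ≤ α * L.dualObj y

/-- An exact LP solver: it returns an optimal solution of the covering LP and one of the packing
LP, whenever these exist. -/
def IsExactSolver (solve : CoverPackLP ID → (ID → ℝ) × (ID → ℝ)) : Prop :=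
  ∀ L : CoverPackLP ID,
    ((∃ x, L.IsPrimalOptimal x) → L.IsPrimalOptimal (solve L).1) ∧
    ((∃ y, L.IsDualOptimal y) → L.IsDualOptimal (solve L).2)

open Classical in
/-- The local sub-LP pair given by a set `S` of dual nodes: the covering LP is restricted to the
inequalities in `S`, its variables are those held by the primal nodes with a neighbor in `S`, and
the packing LP is its dual. All data outside of these rows and columns are erased. -/
noncomputable def subLP (L : CoverPackLP ID) (S : Finset ID) : CoverPackLP ID where
  Vp := L.Vp.filter fun i => ∃ j ∈ S, L.A j i ≠ 0
  Vd := S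
  A j i := if j ∈ S ∧ i ∈ L.Vp ∧ ∃ j' ∈ S, L.A j' i ≠ 0 then L.A j i else 0
  b j := if j ∈ S then L.b j else 0
  c i := if i ∈ L.Vp ∧ ∃ j' ∈ S, L.A j' i ≠ 0 then L.c i else 0
  A_nonneg j i := by
    split_ifs
    · exact L.A_nonneg j i
    · exact le_rfl
  b_nonneg j := by
    split_ifs
    · exact L.b_nonneg j
    · exact le_rfl
  c_nonneg i := by
    split_ifs
    · exact L.c_nonneg i
    · exact le_rfl

end LinearPrograms

section LocalModel

/-- The nodes of the network: `Sum.inl i` is the primal node of `x i` and `Sum.inr j` the dual node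
of `y j`. -/
def IsNode (L : CoverPackLP ID) : ID ⊕ ID → Prop
  | Sum.inl i => i ∈ L.Vp
  | Sum.inr j => j ∈ L.Vd

/-- The (bipartite) network graph: the primal node `i` and the dual node `j` are adjacent iff
`A j i ≠ 0`. Elements of `ID ⊕ ID` that are not nodes of the network are isolated. -/
def network (L : CoverPackLP ID) : SimpleGraph (ID ⊕ ID) :=
  SimpleGraph.fromRel fun u v =>
    ∃ i ∈ L.Vp, ∃ j ∈ L.Vd, L.A j i ≠ 0 ∧ u = Sum.inl i ∧ v = Sum.inr j

/-- The `k`-hop neighborhood of `v` in the network. -/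
def ball (L : CoverPackLP ID) (k : ℕ) (v : ID ⊕ ID) : Set (ID ⊕ ID) :=
  {u | L.network.edist v u ≤ k}

/-- The node `v` has the same `k`-hop view in the network `L` with random inputs `r` as in the
network `L'` with random inputs `r'`: the `k`-hop neighborhoods have the same nodes (with their
identifiers) and the same edges with the same coefficients, and each node in it has the same input
(`c i` at a primal node, `b j` and the random input at a dual node). -/
def SameView {ρ : Type*} (k : ℕ) (v : ID ⊕ ID) (L L' : CoverPackLP ID) (r r' : ID → ρ) : Prop :=
  L.ball k v = L'.ball k v ∧
  (∀ i, Sum.inl i ∈ L.ball k v → L.c i = L'.c i) ∧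
  (∀ j, Sum.inr j ∈ L.ball k v → L.b j = L'.b j ∧ r j = r' j) ∧
  (∀ i j, Sum.inl i ∈ L.ball k v → Sum.inr j ∈ L.ball k v → L.A j i = L'.A j i)

/-- Time complexity in the LOCAL model. A distributed algorithm, given through the output of each
node in each network with given random inputs of the dual nodes (the primal nodes use no
randomness), can be executed in `k` rounds iff the output of each node is a function of its `k`-hop
view. -/
def RunsInRounds {ρ : Type*} (k : ℕ)
    (alg : CoverPackLP ID → (ID → ρ) → ID ⊕ ID → ℝ) : Prop :=
  ∀ (L L' : CoverPackLP ID) (r r' : ID → ρ) (v : ID ⊕ ID),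
    L.IsNode v → L'.IsNode v → SameView k v L L' r r' → alg L r v = alg L' r' v

end LocalModel

section LinialSaks

/-- The graph on the dual nodes in which two distinct dual nodes are adjacent iff their distance in
the network is at most `4`. -/
def dualGraph (L : CoverPackLP ID) : SimpleGraph ID where
  Adj u v := u ≠ v ∧ u ∈ L.Vd ∧ v ∈ L.Vd ∧ L.network.edist (Sum.inr u) (Sum.inr v) ≤ 4
  symm := ⟨fun u v h => ⟨h.1.symm, h.2.2.1, h.2.1, by
    rw [SimpleGraph.edist_comm]; exact h.2.2.2⟩⟩
  loopless := ⟨fun _ h => h.1 rfl⟩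

variable [LinearOrder ID]

open Classical in
/-- Linial-Saks procedure: each dual node `v` broadcasts its identifier and its radius `r v` to all
nodes at distance at most `r v`. This is the set of nodes whose broadcast reaches `u`. -/
noncomputable def heard (L : CoverPackLP ID) (r : ID → ℕ) (u : ID) : Finset ID :=
  L.Vd.filter fun v => L.dualGraph.edist v u ≤ r v

open Classical in
/-- Linial-Saks procedure: `u` chooses as its leader the node `v` of highest identifier whose
broadcast it receives, and joins the selected node set iff its distance to `v` is strictly smaller
than `r v`. This is the cluster of the selected nodes with leader `v`. -/
noncomputable def cluster (L : CoverPackLP ID) (r : ID → ℕ) (v : ID) : Finset ID :=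
  L.Vd.filter fun u => (L.heard r u).max = (v : WithBot ID) ∧ L.dualGraph.edist v u < r v

end LinialSaks

section RadiusLaw

open unitInterval

theorem sum_radiusWeight (p : ℝ) (R : ℕ) :
    ∑ s : Fin (R + 1), (if (s : ℕ) < R then p ^ (s : ℕ) * (1 - p) else p ^ R) = 1 := by
  rw [Fin.sum_univ_castSucc]
  simp only [Fin.val_castSucc, Fin.is_lt, if_true, Fin.val_last, lt_irrefl, if_false]
  rw [Fin.sum_univ_eq_sum_range (fun s => p ^ s * (1 - p)) R, ← Finset.sum_mul,
    geom_sum_mul_neg]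
  ring

/-- The truncated geometric law of a radius: value `s < R` with probability `p ^ s * (1 - p)`, and
value `R` with probability `p ^ R`. -/
noncomputable def radiusLaw (p : I) (R : ℕ) : PMF (Fin (R + 1)) :=
  PMF.ofFintype
    (fun s => ENNReal.ofReal (if (s : ℕ) < R then (p : ℝ) ^ (s : ℕ) * (1 - p) else (p : ℝ) ^ R))
    (by
      rw [← ENNReal.ofReal_sum_of_nonneg, sum_radiusWeight, ENNReal.ofReal_one]
      intro s _
      have h0 : 0 ≤ (p : ℝ) := p.2.1
      have h1 : 0 ≤ 1 - (p : ℝ) := sub_nonneg.2 p.2.2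
      split_ifs <;> positivity)

/-- The joint law of the random inputs: each dual node draws, independently, one radius for each of
the `ℓ` instances of the Linial-Saks procedure. -/
noncomputable def radiiMeasure (L : CoverPackLP ID) (ℓ R : ℕ) (p : I) :
    Measure (L.Vd → Fin ℓ → Fin (R + 1)) :=
  Measure.pi fun _ => Measure.pi fun _ => (radiusLaw p R).toMeasure

open Classical in
/-- Random inputs of the dual nodes, written as a function on all identifiers. -/
noncomputable def extendInput (L : CoverPackLP ID) {ℓ R : ℕ} (ω : L.Vd → Fin ℓ → Fin (R + 1)) :
    ID → Fin ℓ → Fin (R + 1) :=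
  fun j => if h : j ∈ L.Vd then ω ⟨j, h⟩ else 0

end RadiusLaw

section Algorithm

variable [LinearOrder ID]

open Classical in
/-- The primal solution obtained from one instance of the Linial-Saks procedure: the sub-LP of each
cluster is solved separately, and the variables in none of these sub-LPs are set to `0`. (No
variable is in two of them, as distinct clusters are at distance more than `4` in the network.) -/
noncomputable def localPrimal (solve : CoverPackLP ID → (ID → ℝ) × (ID → ℝ)) (L : CoverPackLP ID)
    (r : ID → ℕ) (i : ID) : ℝ :=
  ∑ v ∈ L.Vd, if i ∈ (L.subLP (L.cluster r v)).Vp then (solve (L.subLP (L.cluster r v))).1 i else 0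

open Classical in
/-- The dual solution obtained from one instance of the Linial-Saks procedure. -/
noncomputable def localDual (solve : CoverPackLP ID → (ID → ℝ) × (ID → ℝ)) (L : CoverPackLP ID)
    (r : ID → ℕ) (j : ID) : ℝ :=
  ∑ v ∈ L.Vd, if j ∈ L.cluster r v then (solve (L.subLP (L.cluster r v))).2 j else 0

/-- Sum of the primal solutions of the `ℓ` instances. -/
noncomputable def sumPrimal {ℓ R : ℕ} (solve : CoverPackLP ID → (ID → ℝ) × (ID → ℝ))
    (L : CoverPackLP ID) (r : ID → Fin ℓ → Fin (R + 1)) (i : ID) : ℝ :=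
  ∑ t : Fin ℓ, L.localPrimal solve (fun v => (r v t : ℕ)) i

/-- Sum of the dual solutions of the `ℓ` instances. -/
noncomputable def sumDual {ℓ R : ℕ} (solve : CoverPackLP ID → (ID → ℝ) × (ID → ℝ))
    (L : CoverPackLP ID) (r : ID → Fin ℓ → Fin (R + 1)) (j : ID) : ℝ :=
  ∑ t : Fin ℓ, L.localDual solve (fun v => (r v t : ℕ)) j

open Classical in
/-- The dual nodes `j` adjacent to the primal node `i` whose inequality is not void, i.e. with
`b j ≠ 0`. -/
noncomputable def activeNeighbors (L : CoverPackLP ID) (i : ID) : Finset ID :=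
  L.Vd.filter fun j => L.A j i ≠ 0 ∧ L.b j ≠ 0

open Classical in
/-- Output of the primal node `i`: the summed value `x i`, divided by the minimum of `(A x)_j / b_j`
over the adjacent dual nodes `j`. Here `(A x)_j / 0 = ∞`, i.e. nodes `j` with `b j = 0` do not
count, and division by the empty minimum `∞` gives `0`. -/
noncomputable def primalOutput {ℓ R : ℕ} (solve : CoverPackLP ID → (ID → ℝ) × (ID → ℝ))
    (L : CoverPackLP ID) (r : ID → Fin ℓ → Fin (R + 1)) (i : ID) : ℝ :=
  if h : (L.activeNeighbors i).Nonempty then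
    L.sumPrimal solve r i /
      (L.activeNeighbors i).inf' h fun j => L.rowValue (L.sumPrimal solve r) j / L.b j
  else 0

/-- Output of the dual node `j`: the summed value `y j`, divided by `ℓ`. -/
noncomputable def dualOutput {ℓ R : ℕ} (solve : CoverPackLP ID → (ID → ℝ) × (ID → ℝ))
    (L : CoverPackLP ID) (r : ID → Fin ℓ → Fin (R + 1)) (j : ID) : ℝ :=
  L.sumDual solve r j / ℓ

/-- The distributed algorithm for covering and packing LPs with parameters `ℓ` and `R` (the third
parameter `p` is that of the law of the random inputs): the output of each network node. -/
noncomputable def lpAlgorithm (ℓ R : ℕ) (solve : CoverPackLP ID → (ID → ℝ) × (ID → ℝ))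
    (L : CoverPackLP ID) (r : ID → Fin ℓ → Fin (R + 1)) : ID ⊕ ID → ℝ
  | Sum.inl i => L.primalOutput solve r i
  | Sum.inr j => L.dualOutput solve r j

/-- The probability that the algorithm with parameters `ℓ`, `p`, `R` computes an `α`-approximation
for both the covering LP and the packing LP. -/
noncomputable def successProb (solve : CoverPackLP ID → (ID → ℝ) × (ID → ℝ)) (ℓ R : ℕ)
    (p : unitInterval) (α : ℝ) (L : CoverPackLP ID) : ℝ :=
  (L.radiiMeasure ℓ R p).real
    {ω | L.IsPrimalApprox α (fun i => lpAlgorithm ℓ R solve L (L.extendInput ω) (Sum.inl i)) ∧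
      L.IsDualApprox α (fun j => lpAlgorithm ℓ R solve L (L.extendInput ω) (Sum.inr j))}

end Algorithm

end CoverPackLP

/-!
Every instance of the Linial-Saks procedure yields clusters that are pairwise non-adjacent in the
graph on the dual nodes, so that no variable occurs in the sub-LPs of two clusters
(`leader_eq_of_mem_subLP`). Restricting a feasible solution of the whole LP to the clusters gives
feasible solutions of the sub-LPs. Hence an instance costs at most the primal optimum
(`primalObj_localPrimal_le`), it is feasible for the packing LP (`dualFeasible_localDual`), and on
the nodes it puts into clusters it satisfies the covering inequalities (`le_rowValue_localPrimal`)
and earns at least what any packing solution earns there (`le_dualObj_localDual`). Thus, if each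
dual node is clustered in at least `N` of the `ℓ` instances, both outputs are
`ℓ / N`-approximations (`isPrimalApprox_primalOutput`, `isDualApprox_dualOutput`). LP duality is not
needed, only the existence of optimal solutions of the sub-LPs, which follows from compactness.

For a dual node `u`, the event that `v` is its leader and the event that `u` moreover joins the
cluster of `v` are boxes in the product space of the radii. They differ in the factor of `v` only,
and by the memorylessness of the geometric law their probabilities have ratio `p`, unless `v` is at
distance `R` or more. So `u` is clustered with probability at least `p (1 - n p ^ R)`
(`le_real_clustered`), and with probability `p` if `R` is at least the number of dual nodes
(`real_clustered_of_card_le`). The instances are independent and their number `ℓ` does not influence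
the number of rounds, so Chebyshev's inequality and a union bound suffice for an arbitrarily small
failure probability (`le_successProb`).

The output of a node depends on its `(12 R + 3)`-hop view (`runsInRounds_lpAlgorithm`). It remains to
choose `p ^ R = n ^ (-2)` for the first claim, and `p = 1 - ε / 6` with `R` of order `log n / ε` for
the second.
-/

namespace CoverPackLP

variable {ID : Type*}

/-! ### Existence of optimal solutions -/

theorem exists_isPrimalOptimal (L : CoverPackLP ID) (h : ∃ x, L.PrimalFeasible x) :
    ∃ x, L.IsPrimalOptimal x := by
  classical
  -- A variable `x i` above `M i` satisfies all inequalities in which it occurs.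
  let M : ID → ℝ := fun i => ∑ j ∈ L.Vd, L.b j / L.A j i
  have hM0 : ∀ i, 0 ≤ M i := fun i =>
    Finset.sum_nonneg fun j _ => div_nonneg (L.b_nonneg j) (L.A_nonneg j i)
  let cap : (ID → ℝ) → ID → ℝ := fun x i => if i ∈ L.Vp then min (x i) (M i) else 0
  have hcap : ∀ x, L.PrimalFeasible x →
      L.PrimalFeasible (cap x) ∧ cap x ∈ Set.univ.pi (fun i => Set.Icc 0 (M i)) ∧
        L.primalObj (cap x) ≤ L.primalObj x := by
    intro x hx
    have hc0 : ∀ i, 0 ≤ cap x i := by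
      intro i
      by_cases hi : i ∈ L.Vp
      · simpa [cap, hi] using ⟨hx.1 i hi, hM0 i⟩
      · simp [cap, hi]
    refine ⟨⟨fun i _ => hc0 i, fun j hj => ?_⟩, fun i _ => ⟨hc0 i, ?_⟩, ?_⟩
    · by_cases hbig : ∃ i ∈ L.Vp, L.A j i ≠ 0 ∧ M i < x i
      · obtain ⟨i, hi, hA, hlt⟩ := hbig
        have hApos : 0 < L.A j i := lt_of_le_of_ne (L.A_nonneg j i) hA.symm
        have h1 : L.b j / L.A j i ≤ M i :=
          Finset.single_le_sum (f := fun j => L.b j / L.A j i)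
            (fun j _ => div_nonneg (L.b_nonneg j) (L.A_nonneg j i)) hj
        have h2 : L.A j i * cap x i ≤ L.rowValue (cap x) j :=
          Finset.single_le_sum (f := fun i => L.A j i * cap x i)
            (fun i _ => mul_nonneg (L.A_nonneg j i) (hc0 i)) hi
        have h3 : cap x i = M i := by simp [cap, hi, hlt.le]
        rw [h3] at h2
        rw [div_le_iff₀ hApos] at h1
        linarith
      · push Not at hbig
        have : L.rowValue (cap x) j = L.rowValue x j := by
          refine Finset.sum_congr rfl fun i hi => ?_
          by_cases hA : L.A j i = 0
          · simp [hA]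
          · simp [cap, hi, hbig i hi hA]
        rw [this]
        exact hx.2 j hj
    · by_cases hi : i ∈ L.Vp
      · simp [cap, hi]
      · simpa [cap, hi] using hM0 i
    · refine Finset.sum_le_sum fun i hi => mul_le_mul_of_nonneg_left ?_ (L.c_nonneg i)
      simp [cap, hi]
  have hclosed : IsClosed {x | L.PrimalFeasible x} := by
    have : {x | L.PrimalFeasible x} =
        (⋂ i ∈ L.Vp, {x : ID → ℝ | 0 ≤ x i}) ∩ ⋂ j ∈ L.Vd, {x | L.b j ≤ L.rowValue x j} := by
      ext x; simp [PrimalFeasible]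
    rw [this]
    refine IsClosed.inter (isClosed_biInter fun i _ => ?_) (isClosed_biInter fun j _ => ?_)
    · exact isClosed_le continuous_const (continuous_apply i)
    · refine isClosed_le continuous_const ?_
      unfold rowValue
      fun_prop
  have hcompact : IsCompact (Set.univ.pi (fun i => Set.Icc 0 (M i)) ∩ {x | L.PrimalFeasible x}) :=
    (isCompact_univ_pi fun i => isCompact_Icc).inter_right hclosed
  obtain ⟨x₀, hx₀⟩ := h
  have hcont : Continuous L.primalObj := by unfold primalObj; fun_prop
  obtain ⟨x, hx, hmin⟩ := hcompact.exists_isMinOn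
    ⟨cap x₀, (hcap x₀ hx₀).2.1, (hcap x₀ hx₀).1⟩ hcont.continuousOn
  exact ⟨x, hx.2, fun x' hx' =>
    (hmin ⟨(hcap x' hx').2.1, (hcap x' hx').1⟩).trans (hcap x' hx').2.2⟩

theorem exists_isDualOptimal (L : CoverPackLP ID) (h : ∃ x, L.PrimalFeasible x) :
    ∃ y, L.IsDualOptimal y := by
  classical
  obtain ⟨x₀, hx₀⟩ := h
  let M : ID → ℝ := fun j => ∑ i ∈ L.Vp, L.c i / L.A j i
  have hM0 : ∀ j, 0 ≤ M j := fun j =>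
    Finset.sum_nonneg fun i _ => div_nonneg (L.c_nonneg i) (L.A_nonneg j i)
  -- Only the variables `y j` of void rows are unbounded, and their coefficients `b j` vanish.
  let cut : (ID → ℝ) → ID → ℝ := fun y j =>
    if j ∈ L.Vd ∧ ∃ i ∈ L.Vp, L.A j i ≠ 0 then y j else 0
  have hcut : ∀ y, L.DualFeasible y →
      L.DualFeasible (cut y) ∧ cut y ∈ Set.univ.pi (fun j => Set.Icc 0 (M j)) ∧
        L.dualObj y ≤ L.dualObj (cut y) := by
    intro y hy
    have hc0 : ∀ j, 0 ≤ cut y j := by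
      intro j
      by_cases hj : j ∈ L.Vd ∧ ∃ i ∈ L.Vp, L.A j i ≠ 0
      · simp only [cut, if_pos hj]; exact hy.1 j hj.1
      · simp only [cut, if_neg hj]; exact le_rfl
    refine ⟨⟨fun j _ => hc0 j, fun i hi => ?_⟩, fun j _ => ⟨hc0 j, ?_⟩, ?_⟩
    · refine le_trans (Finset.sum_le_sum fun j hj => ?_) (hy.2 i hi)
      refine mul_le_mul_of_nonneg_left ?_ (L.A_nonneg j i)
      by_cases hj' : j ∈ L.Vd ∧ ∃ i ∈ L.Vp, L.A j i ≠ 0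
      · simp only [cut, if_pos hj']; exact le_rfl
      · simp only [cut, if_neg hj']; exact hy.1 j hj
    · by_cases hj : j ∈ L.Vd ∧ ∃ i ∈ L.Vp, L.A j i ≠ 0
      · simp only [cut, if_pos hj]
        obtain ⟨hj, i, hi, hA⟩ := hj
        have hApos : 0 < L.A j i := lt_of_le_of_ne (L.A_nonneg j i) hA.symm
        have h1 : L.c i / L.A j i ≤ M j :=
          Finset.single_le_sum (f := fun i => L.c i / L.A j i)
            (fun i _ => div_nonneg (L.c_nonneg i) (L.A_nonneg j i)) hi
        have h2 : L.A j i * y j ≤ L.colValue y i :=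
          Finset.single_le_sum (f := fun j => L.A j i * y j)
            (fun j hj => mul_nonneg (L.A_nonneg j i) (hy.1 j hj)) hj
        refine le_trans ?_ h1
        rw [le_div_iff₀ hApos]
        linarith [hy.2 i hi]
      · simp only [cut, if_neg hj]; exact hM0 j
    · refine Finset.sum_le_sum fun j hj => ?_
      by_cases hj' : ∃ i ∈ L.Vp, L.A j i ≠ 0
      · simp only [cut, if_pos (And.intro hj hj')]; exact le_rfl
      · have hb : L.b j ≤ 0 := by
          refine (hx₀.2 j hj).trans (le_of_eq ?_)
          push Not at hj'
          exact Finset.sum_eq_zero fun i hi => by rw [hj' i hi, zero_mul]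
        rw [le_antisymm hb (L.b_nonneg j), zero_mul, zero_mul]
  have hclosed : IsClosed {y | L.DualFeasible y} := by
    have : {y | L.DualFeasible y} =
        (⋂ j ∈ L.Vd, {y : ID → ℝ | 0 ≤ y j}) ∩ ⋂ i ∈ L.Vp, {y | L.colValue y i ≤ L.c i} := by
      ext y; simp [DualFeasible]
    rw [this]
    refine IsClosed.inter (isClosed_biInter fun i _ => ?_) (isClosed_biInter fun j _ => ?_)
    · exact isClosed_le continuous_const (continuous_apply i)
    · refine isClosed_le ?_ continuous_const
      unfold colValue
      fun_prop
  have hcompact : IsCompact (Set.univ.pi (fun j => Set.Icc 0 (M j)) ∩ {y | L.DualFeasible y}) :=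
    (isCompact_univ_pi fun i => isCompact_Icc).inter_right hclosed
  have hzero : L.DualFeasible 0 :=
    ⟨fun _ _ => le_rfl, fun i _ => by simpa [colValue] using L.c_nonneg i⟩
  have hcont : Continuous L.dualObj := by unfold dualObj; fun_prop
  obtain ⟨y, hy, hmax⟩ := hcompact.exists_isMaxOn
    ⟨cut 0, (hcut 0 hzero).2.1, (hcut 0 hzero).1⟩ hcont.continuousOn
  exact ⟨y, hy.2, fun y' hy' =>
    (hcut y' hy').2.2.trans (hmax ⟨(hcut y' hy').2.1, (hcut y' hy').1⟩)⟩

/-! ### Sub-LPs given by sets of dual nodes -/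

theorem mem_subLP_Vp {L : CoverPackLP ID} {S : Finset ID} {i : ID} :
    i ∈ (L.subLP S).Vp ↔ i ∈ L.Vp ∧ ∃ j ∈ S, L.A j i ≠ 0 := by
  classical
  simp [subLP]

theorem subLP_A_eq {L : CoverPackLP ID} {S : Finset ID} {i j : ID}
    (hi : i ∈ (L.subLP S).Vp) (hj : j ∈ S) : (L.subLP S).A j i = L.A j i := by
  rw [mem_subLP_Vp] at hi
  simp only [subLP]
  rw [if_pos ⟨hj, hi⟩]

theorem subLP_b_eq {L : CoverPackLP ID} {S : Finset ID} {j : ID} (hj : j ∈ S) :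
    (L.subLP S).b j = L.b j := by
  simp only [subLP]
  rw [if_pos hj]

theorem subLP_c_eq {L : CoverPackLP ID} {S : Finset ID} {i : ID}
    (hi : i ∈ (L.subLP S).Vp) : (L.subLP S).c i = L.c i := by
  rw [mem_subLP_Vp] at hi
  simp only [subLP]
  rw [if_pos hi]

theorem subLP_rowValue {L : CoverPackLP ID} {S : Finset ID} {j : ID} (hj : j ∈ S) (x : ID → ℝ) :
    (L.subLP S).rowValue x j = L.rowValue x j := by
  classical
  unfold rowValue
  have hsub : (L.subLP S).Vp ⊆ L.Vp := fun i hi => (mem_subLP_Vp.1 hi).1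
  rw [← Finset.sum_subset hsub]
  · exact Finset.sum_congr rfl fun i hi => by rw [subLP_A_eq hi hj]
  · intro i hi hni
    have : L.A j i = 0 := by
      by_contra hA
      exact hni (mem_subLP_Vp.2 ⟨hi, j, hj, hA⟩)
    rw [this, zero_mul]

theorem PrimalFeasible.subLP {L : CoverPackLP ID} {x : ID → ℝ} (hx : L.PrimalFeasible x)
    {S : Finset ID} (hS : S ⊆ L.Vd) : (L.subLP S).PrimalFeasible x := by
  refine ⟨fun i hi => hx.1 i (mem_subLP_Vp.1 hi).1, fun j hj => ?_⟩
  have hj : j ∈ S := hj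
  rw [subLP_b_eq hj, subLP_rowValue hj]
  exact hx.2 j (hS hj)

theorem DualFeasible.subLP {L : CoverPackLP ID} {y : ID → ℝ} (hy : L.DualFeasible y)
    {S : Finset ID} (hS : S ⊆ L.Vd) : (L.subLP S).DualFeasible y := by
  refine ⟨fun j hj => hy.1 j (hS hj), fun i hi => ?_⟩
  rw [subLP_c_eq hi]
  refine le_trans ?_ (hy.2 i (mem_subLP_Vp.1 hi).1)
  calc ∑ j ∈ S, (L.subLP S).A j i * y j = ∑ j ∈ S, L.A j i * y j :=
        Finset.sum_congr rfl fun j hj => by rw [subLP_A_eq hi hj]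
    _ ≤ ∑ j ∈ L.Vd, L.A j i * y j :=
        Finset.sum_le_sum_of_subset_of_nonneg hS
          fun j hj _ => mul_nonneg (L.A_nonneg j i) (hy.1 j hj)

/-! ### The network and its clusters -/

theorem network_adj_inl_inr {L : CoverPackLP ID} {i j : ID} :
    L.network.Adj (Sum.inl i) (Sum.inr j) ↔ i ∈ L.Vp ∧ j ∈ L.Vd ∧ L.A j i ≠ 0 := by
  simp [network, and_left_comm]

theorem network_adj_isNode {L : CoverPackLP ID} {u v : ID ⊕ ID} (h : L.network.Adj u v) :
    L.IsNode u ∧ L.IsNode v := by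
  simp only [network, SimpleGraph.fromRel_adj] at h
  obtain ⟨-, ⟨i, hi, j, hj, -, rfl, rfl⟩ | ⟨i, hi, j, hj, -, rfl, rfl⟩⟩ := h
  · exact ⟨hi, hj⟩
  · exact ⟨hj, hi⟩

theorem dualGraph_adj_of_common {L : CoverPackLP ID} {i j j' : ID} (hi : i ∈ L.Vp)
    (hj : j ∈ L.Vd) (hj' : j' ∈ L.Vd) (h : L.A j i ≠ 0) (h' : L.A j' i ≠ 0) (hne : j ≠ j') :
    L.dualGraph.Adj j j' := by
  refine ⟨hne, hj, hj', ?_⟩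
  have a1 := network_adj_inl_inr.2 ⟨hi, hj, h⟩
  have a2 := network_adj_inl_inr.2 ⟨hi, hj', h'⟩
  exact (SimpleGraph.edist_le (.cons a1.symm (.cons a2 .nil))).trans (by norm_num)

theorem mem_heard {L : CoverPackLP ID} {r : ID → ℕ} {u v : ID} :
    v ∈ L.heard r u ↔ v ∈ L.Vd ∧ L.dualGraph.edist v u ≤ r v := by
  simp [heard]

variable [LinearOrder ID]

theorem mem_cluster {L : CoverPackLP ID} {r : ID → ℕ} {u v : ID} :
    u ∈ L.cluster r v ↔ u ∈ L.Vd ∧ (L.heard r u).max = (v : WithBot ID) ∧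
      L.dualGraph.edist v u < r v := by
  simp [cluster]

theorem cluster_subset {L : CoverPackLP ID} {r : ID → ℕ} {v : ID} : L.cluster r v ⊆ L.Vd :=
  fun _ hu => (mem_cluster.1 hu).1

theorem leader_mem_of_mem_cluster {L : CoverPackLP ID} {r : ID → ℕ} {u v : ID}
    (h : u ∈ L.cluster r v) : v ∈ L.Vd :=
  (mem_heard.1 (Finset.mem_of_max (mem_cluster.1 h).2.1)).1

/-- Clusters with different leaders are not adjacent: a member of a cluster is at distance strictly
less than the radius from its leader, so its neighbors hear that leader as well. -/
theorem leader_eq_of_adj {L : CoverPackLP ID} {r : ID → ℕ} {u u' v v' : ID}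
    (h : u ∈ L.cluster r v) (h' : u' ∈ L.cluster r v') (hadj : L.dualGraph.Adj u u') : v = v' := by
  have key : ∀ {u u' v v' : ID}, u ∈ L.cluster r v → u' ∈ L.cluster r v' →
      L.dualGraph.Adj u u' → v ≤ v' := by
    intro u u' v v' h h' hadj
    obtain ⟨-, -, hd⟩ := mem_cluster.1 h
    have h1 : L.dualGraph.edist v u' ≤ r v := by
      refine (SimpleGraph.edist_triangle (v := u)).trans ?_
      rw [SimpleGraph.edist_eq_one_iff_adj.2 hadj]
      exact Order.add_one_le_of_lt hd
    exact Finset.le_max_of_eq (mem_heard.2 ⟨leader_mem_of_mem_cluster h, h1⟩) (mem_cluster.1 h').2.1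
  exact le_antisymm (key h h' hadj) (key h' h hadj.symm)

theorem leader_unique {L : CoverPackLP ID} {r : ID → ℕ} {u v v' : ID}
    (h : u ∈ L.cluster r v) (h' : u ∈ L.cluster r v') : v = v' := by
  have := (mem_cluster.1 h).2.1.symm.trans (mem_cluster.1 h').2.1
  exact_mod_cast this

theorem leader_eq_of_common {L : CoverPackLP ID} {r : ID → ℕ} {i j j' v v' : ID} (hi : i ∈ L.Vp)
    (hj : j ∈ L.cluster r v) (hj' : j' ∈ L.cluster r v') (h : L.A j i ≠ 0) (h' : L.A j' i ≠ 0) :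
    v = v' := by
  by_cases hne : j = j'
  · subst hne; exact leader_unique hj hj'
  · exact leader_eq_of_adj hj hj'
      (dualGraph_adj_of_common hi (cluster_subset hj) (cluster_subset hj') h h' hne)

/-- No variable occurs in two of the sub-LPs. -/
theorem leader_eq_of_mem_subLP {L : CoverPackLP ID} {r : ID → ℕ} {i v v' : ID}
    (h : i ∈ (L.subLP (L.cluster r v)).Vp) (h' : i ∈ (L.subLP (L.cluster r v')).Vp) : v = v' := by
  obtain ⟨hi, j, hj, hA⟩ := mem_subLP_Vp.1 h
  obtain ⟨-, j', hj', hA'⟩ := mem_subLP_Vp.1 h'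
  exact leader_eq_of_common hi hj hj' hA hA'

variable {solve : CoverPackLP ID → (ID → ℝ) × (ID → ℝ)}

theorem localPrimal_eq {L : CoverPackLP ID} {r : ID → ℕ} {i v : ID}
    (hi : i ∈ (L.subLP (L.cluster r v)).Vp) :
    L.localPrimal solve r i = (solve (L.subLP (L.cluster r v))).1 i := by
  obtain ⟨-, j, hj, -⟩ := mem_subLP_Vp.1 hi
  unfold localPrimal
  rw [Finset.sum_eq_single v, if_pos hi]
  · exact fun v' _ hne => if_neg fun h => hne (leader_eq_of_mem_subLP h hi)
  · exact fun h => absurd (leader_mem_of_mem_cluster hj) h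

theorem localPrimal_eq_zero {L : CoverPackLP ID} {r : ID → ℕ} {i : ID}
    (h : ∀ v, i ∉ (L.subLP (L.cluster r v)).Vp) : L.localPrimal solve r i = 0 :=
  Finset.sum_eq_zero fun v _ => if_neg (h v)

theorem localDual_eq {L : CoverPackLP ID} {r : ID → ℕ} {j v : ID} (hj : j ∈ L.cluster r v) :
    L.localDual solve r j = (solve (L.subLP (L.cluster r v))).2 j := by
  unfold localDual
  rw [Finset.sum_eq_single v, if_pos hj]
  · exact fun v' _ hne => if_neg fun h => hne (leader_unique h hj)
  · exact fun h => absurd (leader_mem_of_mem_cluster hj) h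

theorem localDual_eq_zero {L : CoverPackLP ID} {r : ID → ℕ} {j : ID}
    (h : ∀ v, j ∉ L.cluster r v) : L.localDual solve r j = 0 :=
  Finset.sum_eq_zero fun v _ => if_neg (h v)

/-! ### One instance of the Linial-Saks procedure -/

/-- The dual node `j` is put into some cluster. -/
def Clustered (L : CoverPackLP ID) (r : ID → ℕ) (j : ID) : Prop := ∃ v, j ∈ L.cluster r v

theorem solve_primal_optimal (hs : IsExactSolver solve) {L : CoverPackLP ID}
    (hL : ∃ x, L.PrimalFeasible x) (r : ID → ℕ) (v : ID) :
    (L.subLP (L.cluster r v)).IsPrimalOptimal (solve (L.subLP (L.cluster r v))).1 :=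
  (hs _).1 (exists_isPrimalOptimal _ (hL.imp fun _ hx => hx.subLP cluster_subset))

theorem solve_dual_optimal (hs : IsExactSolver solve) {L : CoverPackLP ID}
    (hL : ∃ x, L.PrimalFeasible x) (r : ID → ℕ) (v : ID) :
    (L.subLP (L.cluster r v)).IsDualOptimal (solve (L.subLP (L.cluster r v))).2 :=
  (hs _).2 (exists_isDualOptimal _ (hL.imp fun _ hx => hx.subLP cluster_subset))

theorem localPrimal_nonneg (hs : IsExactSolver solve) {L : CoverPackLP ID}
    (hL : ∃ x, L.PrimalFeasible x) (r : ID → ℕ) (i : ID) : 0 ≤ L.localPrimal solve r i := by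
  refine Finset.sum_nonneg fun v _ => ?_
  split_ifs with h
  · exact (solve_primal_optimal hs hL r v).1.1 i h
  · exact le_rfl

theorem localDual_nonneg (hs : IsExactSolver solve) {L : CoverPackLP ID}
    (hL : ∃ x, L.PrimalFeasible x) (r : ID → ℕ) (j : ID) : 0 ≤ L.localDual solve r j := by
  refine Finset.sum_nonneg fun v _ => ?_
  split_ifs with h
  · exact (solve_dual_optimal hs hL r v).1.1 j h
  · exact le_rfl

/-- An instance satisfies the inequalities of the nodes that it puts into clusters. -/
theorem le_rowValue_localPrimal (hs : IsExactSolver solve) {L : CoverPackLP ID}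
    (hL : ∃ x, L.PrimalFeasible x) {r : ID → ℕ} {j : ID} (hj : L.Clustered r j) :
    L.b j ≤ L.rowValue (L.localPrimal solve r) j := by
  obtain ⟨v, hv⟩ := hj
  have h := (solve_primal_optimal hs hL r v).1.2 j hv
  rw [subLP_b_eq hv] at h
  refine h.trans (le_of_eq ?_)
  rw [← subLP_rowValue hv (L.localPrimal solve r)]
  exact Finset.sum_congr rfl fun i hi => by rw [localPrimal_eq hi]

/-- The sub-LPs of an instance together cost at most as much as any feasible solution. -/
theorem primalObj_localPrimal_le (hs : IsExactSolver solve) {L : CoverPackLP ID}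
    (r : ID → ℕ) {x : ID → ℝ} (hx : L.PrimalFeasible x) :
    L.primalObj (L.localPrimal solve r) ≤ L.primalObj x := by
  classical
  have h1 : ∀ z : ID → ℝ, ∀ v, (L.subLP (L.cluster r v)).primalObj z =
      ∑ i ∈ L.Vp, if i ∈ (L.subLP (L.cluster r v)).Vp then L.c i * z i else 0 := by
    intro z v
    unfold primalObj
    rw [← Finset.sum_filter]
    refine Finset.sum_congr ?_ fun i hi => ?_
    · ext i
      simp only [Finset.mem_filter, mem_subLP_Vp]
      tauto
    · rw [subLP_c_eq (Finset.mem_filter.1 hi).2]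
  calc L.primalObj (L.localPrimal solve r)
      = ∑ v ∈ L.Vd, (L.subLP (L.cluster r v)).primalObj (solve (L.subLP (L.cluster r v))).1 := by
        simp_rw [h1]
        rw [Finset.sum_comm]
        refine Finset.sum_congr rfl fun i _ => ?_
        rw [localPrimal, Finset.mul_sum]
        exact Finset.sum_congr rfl fun v _ => by rw [mul_ite, mul_zero]
    _ ≤ ∑ v ∈ L.Vd, (L.subLP (L.cluster r v)).primalObj x :=
        Finset.sum_le_sum fun v _ =>
          (solve_primal_optimal hs ⟨x, hx⟩ r v).2 x (hx.subLP cluster_subset)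
    _ ≤ L.primalObj x := by
        simp_rw [h1]
        rw [Finset.sum_comm]
        refine Finset.sum_le_sum fun i hi => ?_
        have h0 : 0 ≤ L.c i * x i := mul_nonneg (L.c_nonneg i) (hx.1 i hi)
        by_cases h : ∃ v, i ∈ (L.subLP (L.cluster r v)).Vp
        · obtain ⟨v, hv⟩ := h
          rw [Finset.sum_eq_single_of_mem v
            (leader_mem_of_mem_cluster (mem_subLP_Vp.1 hv).2.choose_spec.1), if_pos hv]
          exact fun v' _ hne => if_neg fun h => hne (leader_eq_of_mem_subLP h hv)
        · push Not at h
          rwa [Finset.sum_eq_zero fun v _ => if_neg (h v)]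

/-- The dual solutions of the clusters fit together, as each column of the constraint matrix meets
at most one cluster. -/
theorem dualFeasible_localDual (hs : IsExactSolver solve) {L : CoverPackLP ID}
    (hL : ∃ x, L.PrimalFeasible x) (r : ID → ℕ) : L.DualFeasible (L.localDual solve r) := by
  refine ⟨fun j _ => localDual_nonneg hs hL r j, fun i hi => ?_⟩
  by_cases h : ∃ v, i ∈ (L.subLP (L.cluster r v)).Vp
  · obtain ⟨v, hv⟩ := h
    have hfeas := (solve_dual_optimal hs hL r v).1.2 i hv
    rw [subLP_c_eq hv] at hfeas
    refine le_trans (le_of_eq ?_) hfeas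
    change _ = ∑ j ∈ L.cluster r v, _
    unfold colValue
    rw [← Finset.sum_subset cluster_subset]
    · exact Finset.sum_congr rfl fun j hj => by rw [subLP_A_eq hv hj, localDual_eq hj]
    · intro j _ hnj
      by_cases hA : L.A j i = 0
      · rw [hA, zero_mul]
      · rw [localDual_eq_zero, mul_zero]
        intro v' hv'
        have := leader_eq_of_mem_subLP hv (mem_subLP_Vp.2 ⟨hi, j, hv', hA⟩)
        exact hnj (this ▸ hv')
  · push Not at h
    refine le_trans (le_of_eq (Finset.sum_eq_zero fun j _ => ?_)) (L.c_nonneg i)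
    by_cases hA : L.A j i = 0
    · rw [hA, zero_mul]
    · rw [localDual_eq_zero, mul_zero]
      exact fun v' hv' => h v' (mem_subLP_Vp.2 ⟨hi, j, hv', hA⟩)

open Classical in
/-- An instance earns at least the part of the objective value of any feasible solution that
belongs to the nodes that it puts into clusters. -/
theorem le_dualObj_localDual (hs : IsExactSolver solve) {L : CoverPackLP ID}
    (hL : ∃ x, L.PrimalFeasible x) (r : ID → ℕ) {y : ID → ℝ} (hy : L.DualFeasible y) :
    ∑ j ∈ L.Vd, (if L.Clustered r j then L.b j * y j else 0) ≤ L.dualObj (L.localDual solve r) := by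
  have h1 : ∀ z : ID → ℝ, ∀ v, (L.subLP (L.cluster r v)).dualObj z =
      ∑ j ∈ L.Vd, if j ∈ L.cluster r v then L.b j * z j else 0 := by
    intro z v
    unfold dualObj
    rw [← Finset.sum_filter]
    refine Finset.sum_congr ?_ fun j hj => ?_
    · ext j
      simp only [Finset.mem_filter]
      exact ⟨fun h => ⟨cluster_subset h, h⟩, fun h => h.2⟩
    · rw [subLP_b_eq (Finset.mem_filter.1 hj).2]
  calc ∑ j ∈ L.Vd, (if L.Clustered r j then L.b j * y j else 0)
      ≤ ∑ v ∈ L.Vd, (L.subLP (L.cluster r v)).dualObj y := by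
        simp_rw [h1]
        rw [Finset.sum_comm]
        refine Finset.sum_le_sum fun j hj => ?_
        have h0 : 0 ≤ L.b j * y j := mul_nonneg (L.b_nonneg j) (hy.1 j hj)
        have hterm : ∀ v ∈ L.Vd, 0 ≤ if j ∈ L.cluster r v then L.b j * y j else 0 :=
          fun v _ => by split_ifs; exacts [h0, le_rfl]
        split_ifs with h
        · obtain ⟨v, hv⟩ := h
          refine le_trans (le_of_eq ?_)
            (Finset.single_le_sum hterm (leader_mem_of_mem_cluster hv))
          rw [if_pos hv]
        · exact Finset.sum_nonneg hterm
    _ ≤ ∑ v ∈ L.Vd, (L.subLP (L.cluster r v)).dualObj (solve (L.subLP (L.cluster r v))).2 :=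
        Finset.sum_le_sum fun v _ => (solve_dual_optimal hs hL r v).2 y (hy.subLP cluster_subset)
    _ = L.dualObj (L.localDual solve r) := by
        simp_rw [h1]
        rw [Finset.sum_comm]
        refine Finset.sum_congr rfl fun j _ => ?_
        rw [localDual, Finset.mul_sum]
        exact Finset.sum_congr rfl fun v _ => by rw [mul_ite, mul_zero]

/-! ### Approximation ratio in terms of the number of clustered instances -/

variable {ℓ R : ℕ}

open Classical in
/-- The number of instances that put the dual node `j` into a cluster. -/
noncomputable def clusterCount (L : CoverPackLP ID) (r : ID → Fin ℓ → Fin (R + 1)) (j : ID) : ℕ :=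
  (Finset.univ.filter fun t : Fin ℓ => L.Clustered (fun v => (r v t : ℕ)) j).card

theorem sumPrimal_nonneg (hs : IsExactSolver solve) {L : CoverPackLP ID}
    (hL : ∃ x, L.PrimalFeasible x) (r : ID → Fin ℓ → Fin (R + 1)) (i : ID) :
    0 ≤ L.sumPrimal solve r i :=
  Finset.sum_nonneg fun t _ => localPrimal_nonneg hs hL (fun v => (r v t : ℕ)) i

theorem primalObj_sumPrimal_le (hs : IsExactSolver solve) {L : CoverPackLP ID}
    (r : ID → Fin ℓ → Fin (R + 1)) {x : ID → ℝ} (hx : L.PrimalFeasible x) :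
    L.primalObj (L.sumPrimal solve r) ≤ ℓ * L.primalObj x := by
  have : L.primalObj (L.sumPrimal solve r) =
      ∑ t : Fin ℓ, L.primalObj (L.localPrimal solve fun v => (r v t : ℕ)) := by
    simp only [primalObj, sumPrimal, Finset.mul_sum]
    rw [Finset.sum_comm]
  rw [this]
  refine (Finset.sum_le_sum fun t _ => primalObj_localPrimal_le hs _ hx).trans ?_
  simp

theorem clusterCount_mul_le_rowValue (hs : IsExactSolver solve) {L : CoverPackLP ID}
    (hL : ∃ x, L.PrimalFeasible x) (r : ID → Fin ℓ → Fin (R + 1)) (j : ID) :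
    L.clusterCount r j * L.b j ≤ L.rowValue (L.sumPrimal solve r) j := by
  classical
  have : L.rowValue (L.sumPrimal solve r) j =
      ∑ t : Fin ℓ, L.rowValue (L.localPrimal solve fun v => (r v t : ℕ)) j := by
    simp only [rowValue, sumPrimal, Finset.mul_sum]
    rw [Finset.sum_comm]
  rw [this, clusterCount, ← nsmul_eq_mul, ← Finset.sum_const, Finset.sum_filter]
  refine Finset.sum_le_sum fun t _ => ?_
  split_ifs with h
  · exact le_rowValue_localPrimal hs hL h
  · exact Finset.sum_nonneg fun i _ =>
      mul_nonneg (L.A_nonneg j i) (localPrimal_nonneg hs hL (fun v => (r v t : ℕ)) i)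

theorem isPrimalApprox_primalOutput (hs : IsExactSolver solve) {L : CoverPackLP ID}
    (hL : ∃ x, L.PrimalFeasible x) {r : ID → Fin ℓ → Fin (R + 1)} {N α : ℝ} (hN : 0 < N)
    (hcount : ∀ j ∈ L.Vd, N ≤ L.clusterCount r j) (hα : ℓ / N ≤ α) :
    L.IsPrimalApprox α (L.primalOutput solve r) := by
  classical
  set X := L.sumPrimal solve r with hX
  have hX0 : ∀ i, 0 ≤ X i := sumPrimal_nonneg hs hL r
  have hbpos : ∀ j, L.b j ≠ 0 → 0 < L.b j := fun j h => lt_of_le_of_ne (L.b_nonneg j) h.symm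
  have hratio : ∀ j ∈ L.Vd, L.b j ≠ 0 → N ≤ L.rowValue X j / L.b j := by
    intro j hj hb
    rw [le_div_iff₀ (hbpos j hb)]
    exact (mul_le_mul_of_nonneg_right (hcount j hj) (L.b_nonneg j)).trans
      (clusterCount_mul_le_rowValue hs hL r j)
  have hmem : ∀ {i j}, j ∈ L.activeNeighbors i ↔ j ∈ L.Vd ∧ L.A j i ≠ 0 ∧ L.b j ≠ 0 := by
    intro i j; simp [activeNeighbors]
  have hinf : ∀ i (h : (L.activeNeighbors i).Nonempty),
      N ≤ (L.activeNeighbors i).inf' h fun j => L.rowValue X j / L.b j := by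
    intro i h
    refine Finset.le_inf' _ _ fun j hj => ?_
    exact hratio j (hmem.1 hj).1 (hmem.1 hj).2.2
  have hout0 : ∀ i, 0 ≤ L.primalOutput solve r i := by
    intro i
    unfold primalOutput
    split_ifs with h
    · exact div_nonneg (hX0 i) (hN.le.trans (hinf i h))
    · exact le_rfl
  have houtle : ∀ i, L.primalOutput solve r i ≤ X i / N := by
    intro i
    unfold primalOutput
    split_ifs with h
    · exact div_le_div_of_nonneg_left (hX0 i) hN (hinf i h)
    · exact div_nonneg (hX0 i) hN.le
  refine ⟨⟨fun i _ => hout0 i, fun j hj => ?_⟩, fun x' hx' => ?_⟩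
  · by_cases hb : L.b j = 0
    · rw [hb]
      exact Finset.sum_nonneg fun i _ => mul_nonneg (L.A_nonneg j i) (hout0 i)
    · have hrow : 0 < L.rowValue X j := by
        have := (hN.trans_le (hratio j hj hb))
        rwa [lt_div_iff₀ (hbpos j hb), zero_mul] at this
      -- Each variable of row `j` is divided by at most `(A x)_j / b_j`.
      have hle : ∀ i ∈ L.Vp, L.A j i * (X i * (L.b j / L.rowValue X j)) ≤
          L.A j i * L.primalOutput solve r i := by
        intro i _
        by_cases hA : L.A j i = 0
        · simp [hA]
        · refine mul_le_mul_of_nonneg_left ?_ (L.A_nonneg j i)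
          have hj' : j ∈ L.activeNeighbors i := hmem.2 ⟨hj, hA, hb⟩
          have hne : (L.activeNeighbors i).Nonempty := ⟨j, hj'⟩
          unfold primalOutput
          rw [dif_pos hne, ← mul_div_assoc, ← div_div_eq_mul_div]
          exact div_le_div_of_nonneg_left (hX0 i) (hN.trans_le (hinf i hne))
            (Finset.inf'_le (fun j => L.rowValue X j / L.b j) hj')
      calc L.b j = L.rowValue X j * (L.b j / L.rowValue X j) := by
            field_simp
        _ = ∑ i ∈ L.Vp, L.A j i * (X i * (L.b j / L.rowValue X j)) := by
            simp only [rowValue, Finset.sum_mul, mul_assoc]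
        _ ≤ _ := Finset.sum_le_sum hle
  · have h0 : 0 ≤ L.primalObj x' :=
      Finset.sum_nonneg fun i hi => mul_nonneg (L.c_nonneg i) (hx'.1 i hi)
    calc L.primalObj (L.primalOutput solve r) ≤ L.primalObj X / N := by
          simp only [primalObj, Finset.sum_div, mul_div_assoc]
          exact Finset.sum_le_sum fun i _ =>
            mul_le_mul_of_nonneg_left (houtle i) (L.c_nonneg i)
      _ ≤ (ℓ * L.primalObj x') / N :=
          div_le_div_of_nonneg_right (primalObj_sumPrimal_le hs r hx') hN.le
      _ = ℓ / N * L.primalObj x' := by ring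
      _ ≤ α * L.primalObj x' := mul_le_mul_of_nonneg_right hα h0

theorem isDualApprox_dualOutput (hs : IsExactSolver solve) {L : CoverPackLP ID}
    (hL : ∃ x, L.PrimalFeasible x) {r : ID → Fin ℓ → Fin (R + 1)} {N α : ℝ} (hN : 0 < N)
    (hℓ : 1 ≤ ℓ) (hcount : ∀ j ∈ L.Vd, N ≤ L.clusterCount r j) (hα : ℓ / N ≤ α) :
    L.IsDualApprox α (L.dualOutput solve r) := by
  classical
  have hℓ0 : (0 : ℝ) < ℓ := by exact_mod_cast hℓ
  have hfeas := fun t : Fin ℓ => dualFeasible_localDual hs hL fun v => (r v t : ℕ)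
  have hfeasible : L.DualFeasible (L.dualOutput solve r) := by
    refine ⟨fun j hj => ?_, fun i hi => ?_⟩
    · exact div_nonneg (Finset.sum_nonneg fun t _ => (hfeas t).1 j hj) hℓ0.le
    · have : L.colValue (L.dualOutput solve r) i =
          (∑ t : Fin ℓ, L.colValue (L.localDual solve fun v => (r v t : ℕ)) i) / ℓ := by
        simp only [colValue, dualOutput, sumDual]
        rw [Finset.sum_comm, Finset.sum_div]
        exact Finset.sum_congr rfl fun j _ => by rw [← mul_div_assoc, Finset.mul_sum]
      rw [this, div_le_iff₀ hℓ0]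
      refine (Finset.sum_le_sum fun t _ => (hfeas t).2 i hi).trans ?_
      simp [mul_comm]
  refine ⟨hfeasible, fun y hy => ?_⟩
  have hobj : L.dualObj (L.dualOutput solve r) =
      (∑ t : Fin ℓ, L.dualObj (L.localDual solve fun v => (r v t : ℕ))) / ℓ := by
    simp only [dualObj, dualOutput, sumDual]
    rw [Finset.sum_comm, Finset.sum_div]
    exact Finset.sum_congr rfl fun j _ => by rw [← mul_div_assoc, Finset.mul_sum]
  have hsum : N * L.dualObj y ≤
      ∑ t : Fin ℓ, L.dualObj (L.localDual solve fun v => (r v t : ℕ)) := by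
    refine le_trans ?_ (Finset.sum_le_sum fun t _ => le_dualObj_localDual hs hL _ hy)
    rw [Finset.sum_comm, dualObj, Finset.mul_sum]
    refine Finset.sum_le_sum fun j hj => ?_
    rw [← Finset.sum_filter, Finset.sum_const, nsmul_eq_mul]
    exact mul_le_mul_of_nonneg_right (hcount j hj) (mul_nonneg (L.b_nonneg j) (hy.1 j hj))
  have h0 : 0 ≤ L.dualObj (L.dualOutput solve r) :=
    Finset.sum_nonneg fun j hj => mul_nonneg (L.b_nonneg j) (hfeasible.1 j hj)
  calc L.dualObj y ≤ (∑ t : Fin ℓ, L.dualObj (L.localDual solve fun v => (r v t : ℕ))) / N := by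
        rw [le_div_iff₀ hN, mul_comm]; exact hsum
    _ = ℓ / N * L.dualObj (L.dualOutput solve r) := by
        rw [hobj]; field_simp
    _ ≤ α * L.dualObj (L.dualOutput solve r) := mul_le_mul_of_nonneg_right hα h0

end CoverPackLP

namespace CoverPackLP

variable {ID : Type*}

/-! ### Locality of the algorithm -/

theorem edist_le_succ_iff {V : Type*} {G : SimpleGraph V} {u w : V} {s : ℕ} :
    G.edist u w ≤ (s + 1 : ℕ) ↔ u = w ∨ ∃ a, G.Adj u a ∧ G.edist a w ≤ s := by
  constructor
  · intro h
    obtain ⟨p, hp⟩ := SimpleGraph.exists_walk_of_edist_ne_top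
      (ne_top_of_le_ne_top (ENat.natCast_ne_top _) h)
    cases p with
    | nil => exact Or.inl rfl
    | cons hadj q =>
      refine Or.inr ⟨_, hadj, q.edist_le.trans ?_⟩
      rw [← hp] at h
      have h' : q.length + 1 ≤ s + 1 := by exact_mod_cast h
      exact_mod_cast Nat.le_of_succ_le_succ h'
  · rintro (rfl | ⟨a, hadj, ha⟩)
    · simp
    · refine (SimpleGraph.edist_triangle (v := a)).trans ?_
      rw [SimpleGraph.edist_eq_one_iff_adj.2 hadj, add_comm]
      push_cast
      gcongr

theorem isNode_of_edist_le {L : CoverPackLP ID} {k : ℕ} {u v : ID ⊕ ID} (hv : L.IsNode v)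
    (h : L.network.edist v u ≤ k) : L.IsNode u := by
  induction k generalizing v with
  | zero =>
    have : v = u := by simpa using h
    exact this ▸ hv
  | succ k ih =>
    obtain rfl | ⟨a, hadj, ha⟩ := edist_le_succ_iff.1 h
    · exact hv
    · exact ih (network_adj_isNode hadj).2 ha

variable {ρ : Type*} {k m : ℕ} {L L' : CoverPackLP ID} {r r' : ID → ρ} {u v w : ID ⊕ ID}

/-- `v` is a node of both networks and has the same `k`-hop view in them. -/
def AgreeAround (k : ℕ) (v : ID ⊕ ID) (L L' : CoverPackLP ID) (r r' : ID → ρ) : Prop :=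
  L.IsNode v ∧ L'.IsNode v ∧ SameView k v L L' r r'

namespace AgreeAround

theorem symm (h : AgreeAround k v L L' r r') : AgreeAround k v L' L r' r := by
  obtain ⟨h1, h2, hb, hc, hbj, hA⟩ := h
  refine ⟨h2, h1, hb.symm, fun i hi => ?_, fun j hj => ?_, fun i j hi hj => ?_⟩
  · exact (hc i (hb ▸ hi)).symm
  · exact ⟨(hbj j (hb ▸ hj)).1.symm, (hbj j (hb ▸ hj)).2.symm⟩
  · exact (hA i j (hb ▸ hi) (hb ▸ hj)).symm

theorem adj (h : AgreeAround k v L L' r r') (hu : u ∈ L.ball k v) (hw : w ∈ L.ball k v)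
    (hadj : L.network.Adj u w) : L'.network.Adj u w := by
  obtain ⟨h1, h2, hb, hc, hbj, hA⟩ := h
  have hu' : L'.IsNode u := isNode_of_edist_le (k := k) h2 (show u ∈ L'.ball k v from hb ▸ hu)
  have hw' : L'.IsNode w := isNode_of_edist_le (k := k) h2 (show w ∈ L'.ball k v from hb ▸ hw)
  rcases u with i | j <;> rcases w with i' | j'
  · simp [network] at hadj
  · have := (network_adj_inl_inr.1 hadj).2.2
    rw [hA i j' hu hw] at this
    exact network_adj_inl_inr.2 ⟨hu', hw', this⟩
  · have := (network_adj_inl_inr.1 hadj.symm).2.2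
    rw [hA i' j hw hu] at this
    exact (network_adj_inl_inr.2 ⟨hw', hu', this⟩).symm
  · simp [network] at hadj

/-- Paths that stay in the common view exist in both networks. -/
theorem edist_le (h : AgreeAround k v L L' r r') {a b : ℕ} (hab : a + b ≤ k)
    (hu : L.network.edist v u ≤ a) (huw : L.network.edist u w ≤ b) :
    L'.network.edist u w ≤ b := by
  induction b generalizing u a with
  | zero =>
    have : u = w := by simpa using huw
    simp [this]
  | succ b ih =>
    obtain rfl | ⟨x, hadj, hx⟩ := edist_le_succ_iff.1 huw
    · simp
    · have hvx : L.network.edist v x ≤ (a + 1 : ℕ) := by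
        refine (SimpleGraph.edist_triangle (v := u)).trans ?_
        rw [SimpleGraph.edist_eq_one_iff_adj.2 hadj]
        push_cast
        gcongr
      refine edist_le_succ_iff.2 (Or.inr ⟨x, h.adj ?_ ?_ hadj, ih (by omega) hvx hx⟩)
      · exact hu.trans (by exact_mod_cast (by omega : a ≤ k))
      · exact hvx.trans (by exact_mod_cast (by omega : a + 1 ≤ k))

/-- A view contains the views with smaller radius of the nodes that it contains. -/
theorem of_edist_le (h : AgreeAround k v L L' r r') {a b : ℕ} (hab : a + b ≤ k)
    (hu : L.network.edist v u ≤ a) : AgreeAround b u L L' r r' := by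
  have hu' : L'.network.edist v u ≤ a :=
    h.edist_le (a := 0) (b := a) (by omega) (by simp) hu
  have hsub : L.ball b u ⊆ L.ball k v := fun w hw =>
    (SimpleGraph.edist_triangle (v := u)).trans
      ((add_le_add hu hw).trans (by exact_mod_cast hab))
  refine ⟨isNode_of_edist_le h.1 hu, isNode_of_edist_le h.2.1 hu', ?_,
    fun i hi => h.2.2.2.1 i (hsub hi), fun j hj => h.2.2.2.2.1 j (hsub hj),
    fun i j hi hj => h.2.2.2.2.2 i j (hsub hi) (hsub hj)⟩
  ext w
  exact ⟨h.edist_le hab hu, h.symm.edist_le hab hu'⟩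

theorem mono (h : AgreeAround k v L L' r r') {b : ℕ} (hb : b ≤ k) : AgreeAround b v L L' r r' :=
  h.of_edist_le (a := 0) (by omega) (by simp)

/-- The entries of `A` in the row of a node agree if its view contains its neighbors. -/
theorem A_eq {i j : ID} (h : AgreeAround 1 (Sum.inr j) L L' r r')
    (hi : i ∈ L.Vp) (hi' : i ∈ L'.Vp) : L.A j i = L'.A j i := by
  have hj : Sum.inr j ∈ L.ball 1 (Sum.inr j) := by simp [ball]
  by_cases hA : L.A j i = 0
  · by_contra hne
    have hadj := network_adj_inl_inr.2 ⟨hi', h.2.1, fun h0 => hne (hA.trans h0.symm)⟩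
    have hmem : Sum.inl i ∈ L'.ball 1 (Sum.inr j) :=
      (SimpleGraph.edist_eq_one_iff_adj.2 hadj.symm).le
    exact hne (h.2.2.2.2.2 i j (h.2.2.1 ▸ hmem) hj)
  · have hadj := network_adj_inl_inr.2 ⟨hi, h.1, hA⟩
    exact h.2.2.2.2.2 i j (SimpleGraph.edist_eq_one_iff_adj.2 hadj.symm).le hj

theorem neighbor {i j : ID} (h : AgreeAround 1 (Sum.inr j) L L' r r') (hi : i ∈ L.Vp)
    (hA : L.A j i ≠ 0) : i ∈ L'.Vp ∧ L'.A j i ≠ 0 ∧ L.c i = L'.c i := by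
  have hadj := network_adj_inl_inr.2 ⟨hi, h.1, hA⟩
  have hmem : Sum.inl i ∈ L.ball 1 (Sum.inr j) :=
    (SimpleGraph.edist_eq_one_iff_adj.2 hadj.symm).le
  have hi' : i ∈ L'.Vp := isNode_of_edist_le (k := 1) h.2.1
    (show Sum.inl i ∈ L'.ball 1 (Sum.inr j) from h.2.2.1 ▸ hmem)
  exact ⟨hi', h.A_eq hi hi' ▸ hA, h.2.2.2.1 i hmem⟩

theorem of_neighbor {i j : ID}
    (h : AgreeAround (k + 1) (Sum.inl i) L L' r r')
    (hj : j ∈ L.Vd) (hA : L.A j i ≠ 0) : AgreeAround k (Sum.inr j) L L' r r' ∧ L'.A j i ≠ 0 := by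
  have hadj := network_adj_inl_inr.2 ⟨h.1, hj, hA⟩
  have hd : L.network.edist (Sum.inl i) (Sum.inr j) ≤ (1 : ℕ) := by
    simpa using (SimpleGraph.edist_eq_one_iff_adj.2 hadj).le
  refine ⟨h.of_edist_le (a := 1) (by omega) hd, ?_⟩
  have h' := h.adj (by simp [ball]) (hd.trans (by simp)) hadj
  exact (network_adj_inl_inr.1 h').2.2

theorem b_eq {j : ID} (h : AgreeAround k (Sum.inr j) L L' r r') : L.b j = L'.b j :=
  (h.2.2.2.2.1 j (by simp [ball])).1

theorem activeNeighbors_eq {i : ID} (h : AgreeAround (k + 1) (Sum.inl i) L L' r r') :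
    L.activeNeighbors i = L'.activeNeighbors i := by
  classical
  ext j
  simp only [activeNeighbors, Finset.mem_filter]
  constructor
  · rintro ⟨hj, hA, hb⟩
    obtain ⟨h1, h2⟩ := h.of_neighbor hj hA
    exact ⟨h1.2.1, h2, h1.b_eq ▸ hb⟩
  · rintro ⟨hj, hA, hb⟩
    obtain ⟨h1, h2⟩ := h.symm.of_neighbor hj hA
    exact ⟨h1.2.1, h2, h1.b_eq ▸ hb⟩

theorem input_eq {j : ID} (h : AgreeAround k (Sum.inr j) L L' r r') : r j = r' j :=
  (h.2.2.2.2.1 j (by simp [ball])).2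

end AgreeAround

theorem edist_inr_le_of_dualGraph {s : ℕ} {u w : ID} (h : L.dualGraph.edist u w ≤ s) :
    L.network.edist (Sum.inr u) (Sum.inr w) ≤ (4 * s : ℕ) := by
  induction s generalizing u with
  | zero =>
    have : u = w := by simpa using h
    simp [this]
  | succ s ih =>
    obtain rfl | ⟨a, hadj, ha⟩ := edist_le_succ_iff.1 h
    · simp
    · refine (SimpleGraph.edist_triangle (v := Sum.inr a)).trans
        ((add_le_add hadj.2.2.2 (ih ha)).trans ?_)
      exact_mod_cast (by omega : 4 + 4 * s ≤ 4 * (s + 1))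

namespace AgreeAround

theorem dualGraph_edist_le {s : ℕ} {u w : ID} (h : AgreeAround (4 * s) (Sum.inr u) L L' r r')
    (huw : L.dualGraph.edist u w ≤ s) : L'.dualGraph.edist u w ≤ s := by
  induction s generalizing u with
  | zero =>
    have : u = w := by simpa using huw
    simp [this]
  | succ s ih =>
    obtain rfl | ⟨a, hadj, ha⟩ := edist_le_succ_iff.1 huw
    · simp
    · have ha' := h.of_edist_le (a := 4) (b := 4 * s) (by omega) hadj.2.2.2
      refine edist_le_succ_iff.2 (Or.inr ⟨a, ⟨hadj.1, h.2.1, ha'.2.1, ?_⟩, ih ha' ha⟩)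
      exact h.edist_le (a := 0) (b := 4) (by omega) (by simp) hadj.2.2.2

theorem subLP_eq {S : Finset ID} (h : ∀ j ∈ S, AgreeAround 1 (Sum.inr j) L L' r r') :
    L.subLP S = L'.subLP S := by
  classical
  have key : ∀ {L L' : CoverPackLP ID} {r r' : ID → ρ},
      (∀ j ∈ S, AgreeAround 1 (Sum.inr j) L L' r r') → ∀ i,
      (i ∈ L.Vp ∧ ∃ j ∈ S, L.A j i ≠ 0) → i ∈ L'.Vp ∧ ∃ j ∈ S, L'.A j i ≠ 0 := by
    rintro L L' r r' h i ⟨hi, j, hj, hA⟩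
    obtain ⟨h1, h2, -⟩ := (h j hj).neighbor hi hA
    exact ⟨h1, j, hj, h2⟩
  have hiff : ∀ i, (i ∈ L.Vp ∧ ∃ j ∈ S, L.A j i ≠ 0) ↔ i ∈ L'.Vp ∧ ∃ j ∈ S, L'.A j i ≠ 0 :=
    fun i => ⟨key h i, key (fun j hj => (h j hj).symm) i⟩
  ext a b
  · exact mem_subLP_Vp.trans ((hiff a).trans mem_subLP_Vp.symm)
  · rfl
  · simp only [subLP, hiff]
    split_ifs with hc
    · exact (h a hc.1).A_eq ((hiff b).2 hc.2).1 hc.2.1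
    · rfl
  · simp only [subLP]
    split_ifs with hc
    · exact (h a hc).b_eq
    · rfl
  · simp only [subLP, hiff]
    split_ifs with hc
    · obtain ⟨hi, j, hj, hA⟩ := (hiff a).2 hc
      exact ((h j hj).neighbor hi hA).2.2
    · rfl

variable {r r' : ID → ℕ} {R : ℕ}

theorem mem_heard_of {u v : ID} (h : AgreeAround (4 * R) (Sum.inr u) L L' r r')
    (hr : ∀ v, r v ≤ R) (hv : v ∈ L.heard r u) : v ∈ L'.heard r' u := by
  rw [mem_heard, SimpleGraph.edist_comm] at hv ⊢
  have h1 : L.dualGraph.edist u v ≤ R := hv.2.trans (by exact_mod_cast hr v)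
  have hv' := h.of_edist_le (b := 0) le_rfl (edist_inr_le_of_dualGraph h1)
  rw [← hv'.input_eq]
  exact ⟨hv'.2.1, (h.mono (Nat.mul_le_mul_left 4 (hr v))).dualGraph_edist_le hv.2⟩

theorem heard_eq {u : ID} (h : AgreeAround (4 * R) (Sum.inr u) L L' r r')
    (hr : ∀ v, r v ≤ R) (hr' : ∀ v, r' v ≤ R) : L.heard r u = L'.heard r' u :=
  Finset.ext fun _ => ⟨h.mem_heard_of hr, h.symm.mem_heard_of hr'⟩

variable [LinearOrder ID]

theorem mem_cluster_of {u v : ID} (h : AgreeAround (4 * R) (Sum.inr u) L L' r r')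
    (hr : ∀ v, r v ≤ R) (hr' : ∀ v, r' v ≤ R) (hu : u ∈ L.cluster r v) : u ∈ L'.cluster r' v := by
  have hv := mem_heard.1 (Finset.mem_of_max (mem_cluster.1 hu).2.1)
  rw [mem_cluster, SimpleGraph.edist_comm] at hu ⊢
  rw [SimpleGraph.edist_comm] at hv
  have h1 : L.dualGraph.edist u v ≤ R := hv.2.trans (by exact_mod_cast hr v)
  have hv' := h.of_edist_le (b := 0) le_rfl (edist_inr_le_of_dualGraph h1)
  rw [← hv'.input_eq, ← h.heard_eq hr hr']
  refine ⟨h.2.1, hu.2.1, ?_⟩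
  obtain ⟨d, hd⟩ := ENat.ne_top_iff_exists.1 hu.2.2.ne_top
  have hdr : d < r v := by
    have := hu.2.2
    rw [← hd] at this
    exact_mod_cast this
  have hle := (h.mono (Nat.mul_le_mul_left 4 (hdr.le.trans (hr v)))).dualGraph_edist_le hd.ge
  exact hle.trans_lt (by exact_mod_cast hdr)

theorem edist_le_of_mem_cluster {L : CoverPackLP ID} {u w v : ID} (hr : ∀ v, r v ≤ R)
    (hu : u ∈ L.cluster r v) (hw : w ∈ L.cluster r v) :
    L.network.edist (Sum.inr u) (Sum.inr w) ≤ (8 * R : ℕ) := by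
  have hvR : (r v : ℕ∞) ≤ R := by exact_mod_cast hr v
  have h1 := edist_inr_le_of_dualGraph ((mem_cluster.1 hu).2.2.le.trans hvR)
  have h2 := edist_inr_le_of_dualGraph ((mem_cluster.1 hw).2.2.le.trans hvR)
  rw [SimpleGraph.edist_comm] at h1
  refine (SimpleGraph.edist_triangle (v := Sum.inr v)).trans ((add_le_add h1 h2).trans ?_)
  exact_mod_cast (by omega : 4 * R + 4 * R ≤ 8 * R)

/-- The whole cluster of a node is visible in its `12 R`-hop view: the members are at distance at
most `8 R`, and the leader of each member depends on its `4 R`-hop view. -/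
theorem cluster_eq {u v : ID} (h : AgreeAround (12 * R) (Sum.inr u) L L' r r')
    (hr : ∀ v, r v ≤ R) (hr' : ∀ v, r' v ≤ R) (hu : u ∈ L.cluster r v) :
    L.cluster r v = L'.cluster r' v := by
  have hu' := (h.mono (by omega : 4 * R ≤ 12 * R)).mem_cluster_of hr hr' hu
  ext w
  constructor <;> intro hw
  · exact (h.of_edist_le (b := 4 * R) (by omega)
      (edist_le_of_mem_cluster hr hu hw)).mem_cluster_of hr hr' hw
  · exact (h.symm.of_edist_le (b := 4 * R) (by omega)
      (edist_le_of_mem_cluster hr' hu' hw)).mem_cluster_of hr' hr hw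

theorem subLP_cluster_eq {u v : ID} (h : AgreeAround (12 * R) (Sum.inr u) L L' r r') (hR : 1 ≤ R)
    (hr : ∀ v, r v ≤ R) (hr' : ∀ v, r' v ≤ R) (hu : u ∈ L.cluster r v) :
    L.subLP (L.cluster r v) = L'.subLP (L'.cluster r' v) := by
  rw [← h.cluster_eq hr hr' hu]
  exact subLP_eq (r := r) (r' := r') fun j hj =>
    h.of_edist_le (by omega) (edist_le_of_mem_cluster hr hu hj)

variable {solve : CoverPackLP ID → (ID → ℝ) × (ID → ℝ)}

theorem localDual_eq {j : ID} (h : AgreeAround (12 * R) (Sum.inr j) L L' r r') (hR : 1 ≤ R)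
    (hr : ∀ v, r v ≤ R) (hr' : ∀ v, r' v ≤ R) :
    L.localDual solve r j = L'.localDual solve r' j := by
  have h4 := h.mono (by omega : 4 * R ≤ 12 * R)
  by_cases hc : ∃ v, j ∈ L.cluster r v
  · obtain ⟨v, hv⟩ := hc
    rw [CoverPackLP.localDual_eq hv, h.subLP_cluster_eq hR hr hr' hv,
      CoverPackLP.localDual_eq (h4.mem_cluster_of hr hr' hv)]
  · push Not at hc
    rw [localDual_eq_zero hc,
      localDual_eq_zero fun v hv => hc v (h4.symm.mem_cluster_of hr' hr hv)]

theorem localPrimal_eq {i : ID} (h : AgreeAround (12 * R + 1) (Sum.inl i) L L' r r') (hR : 1 ≤ R)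
    (hr : ∀ v, r v ≤ R) (hr' : ∀ v, r' v ≤ R) :
    L.localPrimal solve r i = L'.localPrimal solve r' i := by
  have key : ∀ {L L' : CoverPackLP ID} {r r' : ID → ℕ} {v : ID},
      AgreeAround (12 * R + 1) (Sum.inl i) L L' r r' → (∀ v, r v ≤ R) → (∀ v, r' v ≤ R) →
      i ∈ (L.subLP (L.cluster r v)).Vp →
      L.subLP (L.cluster r v) = L'.subLP (L'.cluster r' v) := by
    intro L L' r r' v h hr hr' hi
    obtain ⟨-, j, hj, hA⟩ := mem_subLP_Vp.1 hi
    exact (h.of_neighbor (cluster_subset hj) hA).1.subLP_cluster_eq hR hr hr' hj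
  by_cases hc : ∃ v, i ∈ (L.subLP (L.cluster r v)).Vp
  · obtain ⟨v, hv⟩ := hc
    have heq := key h hr hr' hv
    rw [CoverPackLP.localPrimal_eq hv, heq, CoverPackLP.localPrimal_eq (heq ▸ hv)]
  · push Not at hc
    rw [localPrimal_eq_zero hc, localPrimal_eq_zero fun v hv => hc v ?_]
    exact key h.symm hr' hr hv ▸ hv

end AgreeAround

section Rounds

variable {ℓ R : ℕ} {r r' : ID → Fin ℓ → Fin (R + 1)}

namespace AgreeAround

theorem instance_input (h : AgreeAround k v L L' r r') (t : Fin ℓ) :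
    AgreeAround k v L L' (fun v => (r v t : ℕ)) (fun v => (r' v t : ℕ)) :=
  ⟨h.1, h.2.1, h.2.2.1, h.2.2.2.1, fun j hj =>
    ⟨(h.2.2.2.2.1 j hj).1, congrArg (fun x => (x t : ℕ)) (h.2.2.2.2.1 j hj).2⟩, h.2.2.2.2.2⟩

variable [LinearOrder ID] {solve : CoverPackLP ID → (ID → ℝ) × (ID → ℝ)}

theorem sumPrimal_eq {i : ID} (h : AgreeAround (12 * R + 1) (Sum.inl i) L L' r r') (hR : 1 ≤ R) :
    L.sumPrimal solve r i = L'.sumPrimal solve r' i :=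
  Finset.sum_congr rfl fun t _ => (h.instance_input t).localPrimal_eq hR
    (fun v => Nat.le_of_lt_succ (r v t).2) (fun v => Nat.le_of_lt_succ (r' v t).2)

theorem sumDual_eq {j : ID} (h : AgreeAround (12 * R) (Sum.inr j) L L' r r') (hR : 1 ≤ R) :
    L.sumDual solve r j = L'.sumDual solve r' j :=
  Finset.sum_congr rfl fun t _ => (h.instance_input t).localDual_eq hR
    (fun v => Nat.le_of_lt_succ (r v t).2) (fun v => Nat.le_of_lt_succ (r' v t).2)

theorem rowValue_eq {j : ID} (h : AgreeAround (12 * R + 2) (Sum.inr j) L L' r r') (hR : 1 ≤ R) :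
    L.rowValue (L.sumPrimal solve r) j = L'.rowValue (L'.sumPrimal solve r') j := by
  classical
  have hset : L.Vp.filter (fun i => L.A j i ≠ 0) = L'.Vp.filter (fun i => L'.A j i ≠ 0) := by
    have h1 := h.mono (by omega : 1 ≤ 12 * R + 2)
    ext i
    simp only [Finset.mem_filter]
    exact ⟨fun hi => ⟨(h1.neighbor hi.1 hi.2).1, (h1.neighbor hi.1 hi.2).2.1⟩,
      fun hi => ⟨(h1.symm.neighbor hi.1 hi.2).1, (h1.symm.neighbor hi.1 hi.2).2.1⟩⟩
  have hfil : ∀ (M : CoverPackLP ID) (x : ID → ℝ),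
      M.rowValue x j = ∑ i ∈ M.Vp.filter (fun i => M.A j i ≠ 0), M.A j i * x i := by
    intro M x
    rw [Finset.sum_filter_of_ne]
    · rfl
    · intro i _ hne h0
      exact hne (by rw [h0, zero_mul])
  rw [hfil, hfil, ← hset]
  refine Finset.sum_congr rfl fun i hi => ?_
  have hi' := hi
  rw [hset] at hi'
  rw [Finset.mem_filter] at hi hi'
  have hd : L.network.edist (Sum.inr j) (Sum.inl i) ≤ (1 : ℕ) := by
    simpa using (SimpleGraph.edist_eq_one_iff_adj.2
      (network_adj_inl_inr.2 ⟨hi.1, h.1, hi.2⟩).symm).le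
  rw [(h.mono (by omega : 1 ≤ 12 * R + 2)).A_eq hi.1 hi'.1,
    (h.of_edist_le (b := 12 * R + 1) (by omega) hd).sumPrimal_eq hR]

theorem primalOutput_eq {i : ID} (h : AgreeAround (12 * R + 3) (Sum.inl i) L L' r r')
    (hR : 1 ≤ R) : L.primalOutput solve r i = L'.primalOutput solve r' i := by
  have hact := h.activeNeighbors_eq
  have hsum := (h.mono (by omega : 12 * R + 1 ≤ 12 * R + 3)).sumPrimal_eq (solve := solve) hR
  unfold primalOutput
  by_cases hne : (L.activeNeighbors i).Nonempty
  · have hne' : (L'.activeNeighbors i).Nonempty := hact ▸ hne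
    rw [dif_pos hne, dif_pos hne', hsum]
    congr 1
    refine Finset.inf'_congr hne hact fun j hj => ?_
    have hj' := hj
    simp only [activeNeighbors, Finset.mem_filter] at hj'
    have hj := (h.of_neighbor hj'.1 hj'.2.1).1
    rw [hj.b_eq, hj.rowValue_eq hR]
  · rw [dif_neg hne, dif_neg (hact ▸ hne)]

end AgreeAround

variable [LinearOrder ID]

/-- The `12 R`-hop view of a dual node determines its cluster. Another hop reaches the variables of
the cluster, and two more the row values by which a primal node normalizes. -/
theorem runsInRounds_lpAlgorithm (solve : CoverPackLP ID → (ID → ℝ) × (ID → ℝ)) {k ℓ R : ℕ}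
    (hR : 1 ≤ R) (hk : 12 * R + 3 ≤ k) : RunsInRounds k (lpAlgorithm ℓ R solve) := by
  rintro L L' r r' (i | j) hv hv' hview
  · exact AgreeAround.primalOutput_eq (AgreeAround.mono ⟨hv, hv', hview⟩ hk) hR
  · have h : AgreeAround (12 * R) (Sum.inr j) L L' r r' :=
      AgreeAround.mono ⟨hv, hv', hview⟩ (by omega)
    simp only [lpAlgorithm, dualOutput, h.sumDual_eq hR]

end Rounds

end CoverPackLP

namespace CoverPackLP

/-! ### The law of a radius -/

section Law

open unitInterval

variable {p : I} {R : ℕ}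

theorem radiusLaw_real_singleton (s : Fin (R + 1)) :
    (radiusLaw p R).toMeasure.real {s} =
      if (s : ℕ) < R then (p : ℝ) ^ (s : ℕ) * (1 - p) else (p : ℝ) ^ R := by
  have h0 : 0 ≤ (p : ℝ) := p.2.1
  have h1 : 0 ≤ 1 - (p : ℝ) := sub_nonneg.2 p.2.2
  rw [measureReal_def, PMF.toMeasure_apply_singleton _ _ (measurableSet_singleton s)]
  simp only [radiusLaw, PMF.ofFintype_apply]
  rw [ENNReal.toReal_ofReal]
  split_ifs <;> positivity

theorem radiusLaw_real_lt {d : ℕ} (hd : d ≤ R) :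
    (radiusLaw p R).toMeasure.real {s | (s : ℕ) < d} = 1 - (p : ℝ) ^ d := by
  induction d with
  | zero => simp
  | succ d ih =>
    have hset : {s : Fin (R + 1) | (s : ℕ) < d + 1} =
        {s : Fin (R + 1) | (s : ℕ) < d} ∪ {(⟨d, by omega⟩ : Fin (R + 1))} := by
      ext s
      simp only [Set.mem_ofPred_eq, Set.mem_union, Set.mem_singleton_iff, Fin.ext_iff]
      omega
    rw [hset, measureReal_union _ (measurableSet_singleton _), ih (by omega),
      radiusLaw_real_singleton, if_pos (by simpa using hd)]
    · simp only [pow_succ]; ring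
    · simp

theorem radiusLaw_real_ge {d : ℕ} (hd : d ≤ R) :
    (radiusLaw p R).toMeasure.real {s | d ≤ (s : ℕ)} = (p : ℝ) ^ d := by
  have hset : {s : Fin (R + 1) | d ≤ (s : ℕ)} = {s : Fin (R + 1) | (s : ℕ) < d}ᶜ := by
    ext s; simp
  rw [hset, probReal_compl_eq_one_sub (MeasurableSet.of_discrete), radiusLaw_real_lt hd]
  ring

/-- The truncated geometric law is memoryless below the truncation. -/
theorem radiusLaw_real_gt {d : ℕ} (hd : d < R) :
    (radiusLaw p R).toMeasure.real {s | d < (s : ℕ)} =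
      p * (radiusLaw p R).toMeasure.real {s | d ≤ (s : ℕ)} := by
  rw [radiusLaw_real_ge hd.le, ← pow_succ']
  exact radiusLaw_real_ge (d := d + 1) hd

end Law

/-! ### The probability to be clustered in one instance -/

section OneInstance

open unitInterval

variable {ID : Type*} {L : CoverPackLP ID} {R : ℕ} {p : I}

/-- The law of the radii of one instance. -/
noncomputable def instanceMeasure (L : CoverPackLP ID) (R : ℕ) (p : I) :
    Measure (L.Vd → Fin (R + 1)) :=
  Measure.pi fun _ => (radiusLaw p R).toMeasure

instance : IsProbabilityMeasure (L.instanceMeasure R p) := by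
  unfold instanceMeasure; infer_instance

open Classical in
/-- The radii of one instance, written as a function on all identifiers. -/
noncomputable def radii (L : CoverPackLP ID) (ω : L.Vd → Fin (R + 1)) : ID → ℕ :=
  fun v => if h : v ∈ L.Vd then ω ⟨v, h⟩ else 0

theorem radii_coe (ω : L.Vd → Fin (R + 1)) (v : L.Vd) : L.radii ω v = ω v := by
  simp [radii]

theorem radii_le (ω : L.Vd → Fin (R + 1)) (v : ID) : L.radii ω v ≤ R := by
  unfold radii
  split_ifs
  · exact Nat.le_of_lt_succ (ω _).2
  · exact Nat.zero_le _

theorem instanceMeasure_real_pi (s : L.Vd → Set (Fin (R + 1))) :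
    (L.instanceMeasure R p).real (Set.univ.pi s) = ∏ v, (radiusLaw p R).toMeasure.real (s v) := by
  rw [measureReal_def, instanceMeasure, Measure.pi_pi, ENNReal.toReal_prod]
  rfl

/-- Nodes joined by a path in the graph on the dual nodes are at distance less than the number of
dual nodes. -/
theorem dualGraph_edist_lt_card {u v : ID} (hu : u ∈ L.Vd) (h : L.dualGraph.edist v u ≠ ⊤) :
    L.dualGraph.edist v u < L.Vd.card := by
  classical
  obtain ⟨q, -⟩ := SimpleGraph.exists_walk_of_edist_ne_top h
  have hsupp : ∀ {a b : ID} (q : L.dualGraph.Walk a b), b ∈ L.Vd → ∀ x ∈ q.support, x ∈ L.Vd := by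
    intro a b q hb x hx
    induction q with
    | nil =>
      rw [SimpleGraph.Walk.support_nil, List.mem_singleton] at hx
      exact hx ▸ hb
    | cons hadj q ih =>
      rw [SimpleGraph.Walk.support_cons, List.mem_cons] at hx
      rcases hx with rfl | hx
      · exact hadj.2.1
      · exact ih hb hx
  have hnodup := (q.bypass_isPath).support_nodup
  have hcard : q.bypass.length + 1 ≤ L.Vd.card := by
    rw [← SimpleGraph.Walk.length_support, ← List.toFinset_card_of_nodup hnodup]
    refine Finset.card_le_card fun x hx => hsupp _ hu x (List.mem_toFinset.1 hx)
  exact q.bypass.edist_le.trans_lt (by exact_mod_cast hcard)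

variable [LinearOrder ID]

/-- `v` is the leader of `u` and closer to `u` than the largest possible radius `R`. -/
def NearLeader (L : CoverPackLP ID) (R : ℕ) (r : ID → ℕ) (u v : ID) : Prop :=
  (L.heard r u).max = (v : WithBot ID) ∧ L.dualGraph.edist v u < R

theorem heard_max_eq_iff {r : ID → ℕ} {u v : ID} :
    (L.heard r u).max = (v : WithBot ID) ↔
      v ∈ L.Vd ∧ L.dualGraph.edist v u ≤ r v ∧
        ∀ w ∈ L.Vd, v < w → (r w : ℕ∞) < L.dualGraph.edist w u := by
  constructor
  · intro h
    have hv := mem_heard.1 (Finset.mem_of_max h)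
    refine ⟨hv.1, hv.2, fun w hw hlt => ?_⟩
    by_contra hle
    exact absurd (Finset.le_max_of_eq (mem_heard.2 ⟨hw, not_lt.1 hle⟩) h) (not_le.2 hlt)
  · rintro ⟨hv, hd, hlt⟩
    refine le_antisymm (Finset.max_le fun w hw => ?_) (Finset.le_max (mem_heard.2 ⟨hv, hd⟩))
    obtain ⟨hw, hwd⟩ := mem_heard.1 hw
    by_contra hle
    exact absurd (hlt w hw (by simpa using hle)) (not_lt.2 hwd)

/-- For every candidate `v`, the event that `v` is the leader of `u` is a box, and so is the event
that moreover `u` joins the cluster of `v`; these boxes differ in the factor of `v` only. -/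
theorem real_mem_cluster (u : ID) (v : ID) (huv : L.dualGraph.edist v u < R) :
    (L.instanceMeasure R p).real
        {ω | (L.heard (L.radii ω) u).max = (v : WithBot ID) ∧ L.dualGraph.edist v u < L.radii ω v} =
      p * (L.instanceMeasure R p).real {ω | (L.heard (L.radii ω) u).max = (v : WithBot ID)} := by
  classical
  by_cases hv : v ∈ L.Vd
  swap
  · have h1 : ∀ ω : L.Vd → Fin (R + 1), (L.heard (L.radii ω) u).max ≠ (v : WithBot ID) :=
      fun ω h => hv (heard_max_eq_iff.1 h).1
    simp [h1]
  obtain ⟨d, hd⟩ := ENat.ne_top_iff_exists.1 huv.ne_top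
  rw [← hd] at huv ⊢
  have hdR : d < R := by exact_mod_cast huv
  let box : Set (Fin (R + 1)) → L.Vd → Set (Fin (R + 1)) := fun s w =>
    if w = ⟨v, hv⟩ then s
    else if v < (w : ID) then {x | ((x : ℕ) : ℕ∞) < L.dualGraph.edist (w : ID) u} else Set.univ
  have hbox : ∀ s (ω : L.Vd → Fin (R + 1)), ω ∈ Set.univ.pi (box s) ↔
      ω ⟨v, hv⟩ ∈ s ∧ ∀ w ∈ L.Vd, v < w → (L.radii ω w : ℕ∞) < L.dualGraph.edist w u := by
    intro s ω
    constructor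
    · intro h
      refine ⟨by simpa [box] using h ⟨v, hv⟩ trivial, fun w hw hlt => ?_⟩
      have := h ⟨w, hw⟩ trivial
      have hne : (⟨w, hw⟩ : L.Vd) ≠ ⟨v, hv⟩ := fun h => hlt.ne' (congrArg Subtype.val h)
      simp only [box, if_neg hne, if_pos hlt] at this
      change ((ω ⟨w, hw⟩ : ℕ) : ℕ∞) < _ at this
      rwa [← radii_coe] at this
    · rintro ⟨h1, h2⟩ w -
      by_cases hw : w = ⟨v, hv⟩
      · subst hw; simpa [box] using h1
      · by_cases hlt : v < (w : ID)
        · simp only [box, if_neg hw, if_pos hlt]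
          have := h2 w w.2 hlt
          rw [radii_coe] at this
          exact this
        · simp only [box, if_neg hw, if_neg hlt, Set.mem_univ]
  have hleader : {ω : L.Vd → Fin (R + 1) | (L.heard (L.radii ω) u).max = (v : WithBot ID)} =
      Set.univ.pi (box {x | d ≤ (x : ℕ)}) := by
    ext ω
    rw [hbox, Set.mem_ofPred_eq, heard_max_eq_iff, ← hd]
    simp only [hv, true_and, Nat.cast_le, Set.mem_ofPred_eq, ← radii_coe ω ⟨v, hv⟩]
  have hjoin : {ω : L.Vd → Fin (R + 1) |
        (L.heard (L.radii ω) u).max = (v : WithBot ID) ∧ (d : ℕ∞) < L.radii ω v} =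
      Set.univ.pi (box {x | d < (x : ℕ)}) := by
    ext ω
    rw [hbox, Set.mem_ofPred_eq, heard_max_eq_iff, ← hd]
    simp only [hv, true_and, Nat.cast_le, Nat.cast_lt, Set.mem_ofPred_eq,
      ← radii_coe ω ⟨v, hv⟩]
    exact ⟨fun h => ⟨h.2, h.1.2⟩, fun h => ⟨⟨h.1.le, h.2⟩, h.1⟩⟩
  have hrest : ∀ s, ∏ w, (radiusLaw p R).toMeasure.real (box s w) =
      (radiusLaw p R).toMeasure.real s *
        ∏ w ∈ Finset.univ.erase (⟨v, hv⟩ : L.Vd),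
          (radiusLaw p R).toMeasure.real (box Set.univ w) := by
    intro s
    rw [← Finset.mul_prod_erase _ _ (Finset.mem_univ (⟨v, hv⟩ : L.Vd))]
    congr 1
    · simp [box]
    · refine Finset.prod_congr rfl fun w hw => ?_
      simp [box, Finset.ne_of_mem_erase hw]
  rw [hleader, hjoin, instanceMeasure_real_pi, instanceMeasure_real_pi, hrest, hrest,
    radiusLaw_real_gt hdR, mul_assoc]

/-- A node whose leader is nearer than `R` joins the cluster with probability `p`. -/
theorem real_clustered (u : ID) (hu : u ∈ L.Vd) :
    (L.instanceMeasure R p).real {ω | L.Clustered (L.radii ω) u} =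
      p * (L.instanceMeasure R p).real {ω | ∃ v, L.NearLeader R (L.radii ω) u v} := by
  classical
  let near : Finset ID := L.Vd.filter fun v => L.dualGraph.edist v u < R
  let E : ID → Set (L.Vd → Fin (R + 1)) := fun v => {ω | (L.heard (L.radii ω) u).max = v}
  let F : ID → Set (L.Vd → Fin (R + 1)) := fun v =>
    {ω | (L.heard (L.radii ω) u).max = v ∧ L.dualGraph.edist v u < L.radii ω v}
  have hdisj : (near : Set ID).PairwiseDisjoint E := by
    intro v _ w _ hne
    refine Set.disjoint_left.2 fun ω h h' => hne ?_
    have : (v : WithBot ID) = w := h.symm.trans h'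
    exact_mod_cast this
  have hE : {ω : L.Vd → Fin (R + 1) | ∃ v, L.NearLeader R (L.radii ω) u v} = ⋃ v ∈ near, E v := by
    ext ω
    simp only [near, E, Set.mem_ofPred_eq, Set.mem_iUnion, exists_prop, Finset.mem_filter]
    refine exists_congr fun v => ?_
    constructor
    · rintro ⟨h1, h2⟩
      exact ⟨⟨(heard_max_eq_iff.1 h1).1, h2⟩, h1⟩
    · rintro ⟨⟨-, h2⟩, h1⟩
      exact ⟨h1, h2⟩
  have hF : {ω : L.Vd → Fin (R + 1) | L.Clustered (L.radii ω) u} = ⋃ v ∈ near, F v := by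
    ext ω
    simp only [near, F, Set.mem_ofPred_eq, Set.mem_iUnion, exists_prop, Finset.mem_filter,
      Clustered, mem_cluster]
    refine exists_congr fun v => ?_
    constructor
    · rintro ⟨-, h1, h2⟩
      exact ⟨⟨(heard_max_eq_iff.1 h1).1, h2.trans_le (by exact_mod_cast radii_le ω v)⟩, h1, h2⟩
    · rintro ⟨-, h1, h2⟩
      exact ⟨hu, h1, h2⟩
  rw [hE, hF, measureReal_biUnion_finset hdisj fun _ _ => MeasurableSet.of_discrete,
    measureReal_biUnion_finset (hdisj.mono fun v => fun ω h => h.1)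
      fun _ _ => MeasurableSet.of_discrete, Finset.mul_sum]
  exact Finset.sum_congr rfl fun v hv => real_mem_cluster u v (Finset.mem_filter.1 hv).2

theorem exists_leader {r : ID → ℕ} {u : ID} (hu : u ∈ L.Vd) :
    ∃ v ∈ L.Vd, (L.heard r u).max = (v : WithBot ID) ∧ L.dualGraph.edist v u ≤ r v := by
  obtain ⟨v, hv⟩ := Finset.max_of_mem (mem_heard.2 (⟨hu, by simp⟩ :
    u ∈ L.Vd ∧ L.dualGraph.edist u u ≤ r u))
  exact ⟨v, (mem_heard.1 (Finset.mem_of_max hv)).1, hv, (mem_heard.1 (Finset.mem_of_max hv)).2⟩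

/-- A node has a near leader unless some radius is truncated. -/
theorem le_real_clustered {n : ℕ} (hn : L.Vd.card ≤ n) {u : ID} (hu : u ∈ L.Vd) :
    (p : ℝ) * (1 - n * (p : ℝ) ^ R) ≤
      (L.instanceMeasure R p).real {ω | L.Clustered (L.radii ω) u} := by
  have hp0 : 0 ≤ (p : ℝ) := p.2.1
  have hpR : (p : ℝ) ^ R ≤ 1 := pow_le_one₀ hp0 p.2.2
  rw [real_clustered u hu]
  refine mul_le_mul_of_nonneg_left ?_ hp0
  have hsub : Set.univ.pi (fun _ : L.Vd => {s : Fin (R + 1) | (s : ℕ) < R}) ⊆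
      {ω | ∃ v, L.NearLeader R (L.radii ω) u v} := by
    intro ω hω
    obtain ⟨v, hv, hmax, hd⟩ := exists_leader (r := L.radii ω) hu
    refine ⟨v, hmax, hd.trans_lt ?_⟩
    have h1 : (ω ⟨v, hv⟩ : ℕ) < R := hω ⟨v, hv⟩ trivial
    rw [← radii_coe ω ⟨v, hv⟩] at h1
    exact_mod_cast h1
  refine le_trans ?_ (measureReal_mono hsub)
  rw [instanceMeasure_real_pi]
  simp only [radiusLaw_real_lt le_rfl, Finset.prod_const, Finset.card_univ, Fintype.card_coe]
  have hb := one_add_mul_le_pow (a := -(p : ℝ) ^ R) (by linarith) L.Vd.card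
  rw [← sub_eq_add_neg] at hb
  refine le_trans ?_ hb
  have hcard : (L.Vd.card : ℝ) ≤ n := by exact_mod_cast hn
  have := mul_le_mul_of_nonneg_right hcard (pow_nonneg hp0 R)
  linarith

/-- If `R` is at least the number of dual nodes, all leaders are near. -/
theorem real_clustered_of_card_le (hR : L.Vd.card ≤ R) {u : ID} (hu : u ∈ L.Vd) :
    (L.instanceMeasure R p).real {ω | L.Clustered (L.radii ω) u} = p := by
  rw [real_clustered u hu]
  have : {ω : L.Vd → Fin (R + 1) | ∃ v, L.NearLeader R (L.radii ω) u v} = Set.univ := by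
    refine Set.eq_univ_of_forall fun ω => ?_
    obtain ⟨v, -, hmax, hd⟩ := exists_leader (r := L.radii ω) hu
    refine ⟨v, hmax, lt_of_lt_of_le (dualGraph_edist_lt_card hu ?_) (by exact_mod_cast hR)⟩
    exact ne_top_of_le_ne_top (ENat.natCast_ne_top _) hd
  rw [this, probReal_univ, mul_one]

end OneInstance

/-! ### Concentration over the instances -/

section Concentration

open unitInterval

open Classical in
/-- By Chebyshev's inequality, an event of probability at least `q` rarely occurs in less than a
`(1 - δ) q` fraction of `ℓ` independent trials. -/
theorem real_count_lt_le {Ω : Type*} [MeasurableSpace Ω] [Finite Ω] [DiscreteMeasurableSpace Ω]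
    (ν : Measure Ω) [IsProbabilityMeasure ν] (S : Set Ω) {q δ : ℝ} (hq : 0 < q)
    (hS : q ≤ ν.real S) (hδ : 0 < δ) (hδ1 : δ ≤ 1) {ℓ : ℕ} (hℓ : 1 ≤ ℓ) :
    (Measure.pi fun _ : Fin ℓ => ν).real
        {ω | ((Finset.univ.filter fun t => ω t ∈ S).card : ℝ) < (1 - δ) * q * ℓ} ≤
      1 / (δ ^ 2 * q * ℓ) := by
  have hℓ0 : (0 : ℝ) < ℓ := by exact_mod_cast hℓ
  set s := ν.real S with hs
  have hs0 : 0 < s := hq.trans_le hS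
  let f : Ω → ℝ := S.indicator 1
  have hf : MemLp f 2 ν := MemLp.of_discrete
  let X : (Fin ℓ → Ω) → ℝ := ∑ t : Fin ℓ, fun ω => f (ω t)
  have hX : ∀ ω, X ω = ((Finset.univ.filter fun t => ω t ∈ S).card : ℝ) := by
    intro ω
    simp [X, f, Finset.sum_apply, Set.indicator_apply]
  have hfint : ∫ x, f x ∂ν = s := by
    rw [hs]
    exact integral_indicator_one MeasurableSet.of_discrete
  have hmean : ∫ ω, X ω ∂(Measure.pi fun _ : Fin ℓ => ν) = ℓ * s := by
    simp only [X, Finset.sum_apply]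
    rw [integral_finsetSum _ fun t _ => Integrable.of_finite]
    have : ∀ t : Fin ℓ, ∫ ω, f (ω t) ∂(Measure.pi fun _ : Fin ℓ => ν) = s := fun t => by
      rw [← hfint]
      exact integral_comp_eval (μ := fun _ : Fin ℓ => ν) (i := t) hf.aestronglyMeasurable
    simp [this]
  have hvar1 : ProbabilityTheory.variance f ν ≤ s := by
    refine (ProbabilityTheory.variance_le_expectation_sq hf.aestronglyMeasurable).trans
      (le_of_eq ?_)
    rw [← hfint]
    congr 1
    ext x
    by_cases hx : x ∈ S <;> simp [f, hx]
  have hvar : ProbabilityTheory.variance X (Measure.pi fun _ : Fin ℓ => ν) ≤ ℓ * s := by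
    rw [ProbabilityTheory.variance_sum_pi (X := fun _ => f) fun _ => hf]
    simpa using mul_le_mul_of_nonneg_left hvar1 hℓ0.le
  have hc : 0 < δ * (ℓ * s) := by positivity
  have hcheb := ProbabilityTheory.meas_ge_le_variance_div_sq
    (μ := Measure.pi fun _ : Fin ℓ => ν) (X := X) MemLp.of_discrete hc
  rw [hmean] at hcheb
  have hcheb' : (Measure.pi fun _ : Fin ℓ => ν).real {ω | δ * (ℓ * s) ≤ |X ω - ℓ * s|} ≤
      ProbabilityTheory.variance X (Measure.pi fun _ : Fin ℓ => ν) / (δ * (ℓ * s)) ^ 2 :=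
    ENNReal.toReal_le_of_le_ofReal
      (div_nonneg (ProbabilityTheory.variance_nonneg _ _) (sq_nonneg _)) hcheb
  have hsub : {ω : Fin ℓ → Ω |
      ((Finset.univ.filter fun t => ω t ∈ S).card : ℝ) < (1 - δ) * q * ℓ} ⊆
      {ω | δ * (ℓ * s) ≤ |X ω - ℓ * s|} := by
    intro ω hω
    rw [Set.mem_ofPred_eq, ← hX] at hω
    have h1 : (1 - δ) * q * ℓ ≤ (1 - δ) * s * ℓ :=
      mul_le_mul_of_nonneg_right (mul_le_mul_of_nonneg_left hS (by linarith)) hℓ0.le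
    have h2 : -(X ω - ℓ * s) ≤ |X ω - ℓ * s| := neg_le_abs _
    change δ * (ℓ * s) ≤ |X ω - ℓ * s|
    nlinarith
  calc _ ≤ _ := measureReal_mono hsub
    _ ≤ _ := hcheb'
    _ ≤ (ℓ * s) / (δ * (ℓ * s)) ^ 2 := div_le_div_of_nonneg_right hvar (sq_nonneg _)
    _ = 1 / (δ ^ 2 * s * ℓ) := by field_simp
    _ ≤ 1 / (δ ^ 2 * q * ℓ) :=
        one_div_le_one_div_of_le (by positivity) (by gcongr)

variable {ID : Type*} {L : CoverPackLP ID} {ℓ R : ℕ} {p : I}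

theorem radiiMeasure_map_swap :
    (L.radiiMeasure ℓ R p).map (fun ω t v => ω v t) =
      Measure.pi fun _ : Fin ℓ => L.instanceMeasure R p := by
  refine Measure.ext_of_singleton fun f => ?_
  have hpre : (fun (ω : L.Vd → Fin ℓ → Fin (R + 1)) t v => ω v t) ⁻¹' {f} =
      {fun v t => f t v} := by
    ext ω
    simp only [Set.mem_preimage, Set.mem_singleton_iff, funext_iff]
    exact forall_comm
  rw [Measure.map_apply (by fun_prop) (measurableSet_singleton f), hpre, radiiMeasure,
    Measure.pi_singleton, Measure.pi_singleton]
  simp only [instanceMeasure, Measure.pi_singleton]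
  exact Finset.prod_comm

instance : IsProbabilityMeasure (L.radiiMeasure ℓ R p) := by
  unfold radiiMeasure; infer_instance

variable [LinearOrder ID] {solve : CoverPackLP ID → (ID → ℝ) × (ID → ℝ)}

theorem real_clusterCount_lt_le {q δ : ℝ} (hq : 0 < q) (hδ : 0 < δ) (hδ1 : δ ≤ 1) (hℓ : 1 ≤ ℓ)
    {u : ID} (hu : q ≤ (L.instanceMeasure R p).real {ω | L.Clustered (L.radii ω) u}) :
    (L.radiiMeasure ℓ R p).real
        {ω | (L.clusterCount (L.extendInput ω) u : ℝ) < (1 - δ) * q * ℓ} ≤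
      1 / (δ ^ 2 * q * ℓ) := by
  classical
  have h := real_count_lt_le (L.instanceMeasure R p) {ω | L.Clustered (L.radii ω) u} hq hu hδ hδ1 hℓ
  rw [← radiiMeasure_map_swap, map_measureReal_apply (by fun_prop) MeasurableSet.of_discrete] at h
  refine le_trans (le_of_eq ?_) h
  congr 1
  ext ω
  simp only [Set.mem_preimage, Set.mem_ofPred_eq, clusterCount]
  have : ∀ t, (fun v => (L.extendInput ω v t : ℕ)) = L.radii fun v => ω v t := by
    intro t
    ext v
    unfold extendInput radii
    split_ifs <;> simp
  simp only [this]

/-- If each dual node is clustered with probability at least `q` in an instance, then with high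
probability each one is clustered in a `(1 - δ) q` fraction of the instances, which bounds the
approximation ratio by `1 / ((1 - δ) q)`. -/
theorem le_successProb (hs : IsExactSolver solve) (hL : ∃ x, L.PrimalFeasible x) {n : ℕ}
    (hn : L.Vd.card ≤ n) {q δ α : ℝ} (hq : 0 < q) (hδ : 0 < δ) (hδ1 : δ < 1) (hℓ : 1 ≤ ℓ)
    (hclus : ∀ u ∈ L.Vd, q ≤ (L.instanceMeasure R p).real {ω | L.Clustered (L.radii ω) u})
    (hα : 1 / ((1 - δ) * q) ≤ α) :
    1 - n * (1 / (δ ^ 2 * q * ℓ)) ≤ successProb solve ℓ R p α L := by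
  have hℓ0 : (0 : ℝ) < ℓ := by exact_mod_cast hℓ
  have hN : 0 < (1 - δ) * q * ℓ := mul_pos (mul_pos (by linarith) hq) hℓ0
  have hratio : ℓ / ((1 - δ) * q * ℓ) ≤ α := by
    refine le_trans (le_of_eq ?_) hα
    have : (1 - δ) ≠ 0 := by linarith
    field_simp
  let bad : ID → Set (L.Vd → Fin ℓ → Fin (R + 1)) := fun u =>
    {ω | (L.clusterCount (L.extendInput ω) u : ℝ) < (1 - δ) * q * ℓ}
  have hbad : (L.radiiMeasure ℓ R p).real (⋃ u ∈ L.Vd, bad u) ≤ n * (1 / (δ ^ 2 * q * ℓ)) := by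
    refine (measureReal_biUnion_finset_le _ _).trans ?_
    refine (Finset.sum_le_sum fun u hu =>
      real_clusterCount_lt_le hq hδ hδ1.le hℓ (hclus u hu)).trans ?_
    rw [Finset.sum_const, nsmul_eq_mul]
    exact mul_le_mul_of_nonneg_right (by exact_mod_cast hn) (by positivity)
  have hgood : (⋃ u ∈ L.Vd, bad u)ᶜ ⊆
      {ω | L.IsPrimalApprox α (fun i => lpAlgorithm ℓ R solve L (L.extendInput ω) (Sum.inl i)) ∧
        L.IsDualApprox α (fun j => lpAlgorithm ℓ R solve L (L.extendInput ω) (Sum.inr j))} := by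
    intro ω hω
    have hcount : ∀ j ∈ L.Vd, (1 - δ) * q * ℓ ≤ L.clusterCount (L.extendInput ω) j := by
      intro j hj
      by_contra hlt
      exact hω (Set.mem_biUnion hj (not_le.1 hlt))
    exact ⟨isPrimalApprox_primalOutput hs hL hN hcount hratio,
      isDualApprox_dualOutput hs hL hN hℓ hcount hratio⟩
  refine le_trans ?_ (measureReal_mono hgood)
  rw [probReal_compl_eq_one_sub MeasurableSet.of_discrete]
  linarith

end Concentration

end CoverPackLP

namespace CoverPackLP

/-! ### Choice of the parameters -/

/-- With sufficiently many instances the failure probability is as small as required. -/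
theorem exists_instances {n : ℕ} (hn : 2 ≤ n) (β : ℝ) {q δ : ℝ} (hq : 0 < q) (hδ : 0 < δ) :
    ∃ ℓ : ℕ, 1 ≤ ℓ ∧ n * (1 / (δ ^ 2 * q * ℓ)) ≤ (n : ℝ) ^ (-β) := by
  have hn0 : (0 : ℝ) < n := by exact_mod_cast (by omega : 0 < n)
  have hε : 0 < (n : ℝ) ^ (-β) := Real.rpow_pos_of_pos hn0 _
  obtain ⟨ℓ, hℓ⟩ := exists_nat_gt (n / (δ ^ 2 * q * (n : ℝ) ^ (-β)))
  have hℓ0 : (0 : ℝ) < ℓ := lt_trans (by positivity) hℓ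
  refine ⟨ℓ, by exact_mod_cast hℓ0, ?_⟩
  rw [div_lt_iff₀ (by positivity)] at hℓ
  rw [mul_one_div, div_le_iff₀ (by positivity)]
  linarith

/-- Parameters for few rounds: with `p ^ R = n ^ (-2)` some radius is truncated with probability
at most `1 / 2`, and a node is clustered with probability at least `p / 2 = n ^ (-2 / R) / 2`. -/
theorem exists_parameters_few_rounds (β : ℝ) {k : ℕ} (hk : 15 ≤ k) {n : ℕ} (hn : 2 ≤ n) :
    ∃ (ℓ R : ℕ) (p : unitInterval), 1 ≤ ℓ ∧ 1 ≤ R ∧ 12 * R + 3 ≤ k ∧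
      ∀ (ID : Type*) [LinearOrder ID] (solve : CoverPackLP ID → (ID → ℝ) × (ID → ℝ)),
        IsExactSolver solve → ∀ L : CoverPackLP ID, L.Vd.card ≤ n → (∃ x, L.PrimalFeasible x) →
          1 - (n : ℝ) ^ (-β) ≤ successProb solve ℓ R p (4 * (n : ℝ) ^ ((60 : ℝ) / (k : ℝ))) L := by
  have hn2 : (2 : ℝ) ≤ n := by exact_mod_cast hn
  have hn0 : (0 : ℝ) < n := by linarith
  have hn1 : (1 : ℝ) ≤ n := by linarith
  obtain ⟨R, hR1, hRk, hkR⟩ : ∃ R : ℕ, 1 ≤ R ∧ 15 * R ≤ k ∧ k ≤ 30 * R :=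
    ⟨k / 15, by omega, by omega, by omega⟩
  have hR0 : (0 : ℝ) < R := by exact_mod_cast hR1
  have hk0 : (0 : ℝ) < k := by exact_mod_cast (by omega : 0 < k)
  let P : ℝ := (n : ℝ) ^ (-(2 / (R : ℝ)))
  have hP0 : 0 < P := Real.rpow_pos_of_pos hn0 _
  have hP1 : P ≤ 1 := Real.rpow_le_one_of_one_le_of_nonpos hn1 (by
    have : 0 ≤ 2 / (R : ℝ) := by positivity
    linarith)
  let p : unitInterval := ⟨P, hP0.le, hP1⟩
  have hpR : n * P ^ R ≤ 1 / 2 := by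
    have : P ^ R = ((n : ℝ) ^ 2)⁻¹ := by
      rw [← Real.rpow_natCast, ← Real.rpow_mul hn0.le,
        show -(2 / (R : ℝ)) * R = -(2 : ℕ) by push_cast; field_simp,
        Real.rpow_neg hn0.le, Real.rpow_natCast]
    rw [this, pow_two, mul_inv, ← mul_assoc, mul_inv_cancel₀ hn0.ne', one_mul, one_div]
    exact inv_anti₀ (by norm_num) hn2
  obtain ⟨ℓ, hℓ, hfail⟩ := exists_instances hn β (q := P / 2) (δ := 1 / 2) (by positivity)
    (by norm_num)
  refine ⟨ℓ, R, p, hℓ, hR1, by omega, fun ID _ solve hs L hL hfeas => ?_⟩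
  refine le_trans (by linarith) (le_successProb (q := P / 2) (δ := 1 / 2) hs hfeas hL
    (by positivity) (by norm_num) (by norm_num) hℓ (fun u hu => ?_) ?_)
  · refine le_trans ?_ (le_real_clustered hL hu)
    change P / 2 ≤ P * (1 - n * P ^ R)
    nlinarith
  · calc 1 / ((1 - 1 / 2) * (P / 2)) = 4 * P⁻¹ := by field_simp; norm_num
      _ = 4 * (n : ℝ) ^ (2 / (R : ℝ)) := by
          rw [← Real.rpow_neg hn0.le, neg_neg]
      _ ≤ 4 * (n : ℝ) ^ ((60 : ℝ) / (k : ℝ)) := by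
          refine mul_le_mul_of_nonneg_left (Real.rpow_le_rpow_of_exponent_le hn1 ?_) (by norm_num)
          rw [div_le_div_iff₀ hR0 hk0]
          have : (k : ℝ) ≤ 30 * R := by exact_mod_cast hkR
          linarith

/-- Parameters for approximation ratio `1 + ε`: take `p = 1 - ε / 6` and `R` of order
`log n / ε`. If `ε ≥ 1 / n` then `log (n / ε) ≤ 2 log n`, so that this `R` is large enough for
some radius to be truncated with probability at most `ε / 6`; if `ε < 1 / n` then `R ≥ n`, and
truncation has no influence. -/
theorem exists_parameters_small_ratio (β : ℝ) {ε : ℝ} (hε : 0 < ε) (hε1 : ε < 1) {n : ℕ}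
    (hn : 2 ≤ n) :
    ∃ (k ℓ R : ℕ) (p : unitInterval), (k : ℝ) ≤ 400 * Real.log n / ε ∧ 1 ≤ ℓ ∧ 1 ≤ R ∧
      12 * R + 3 ≤ k ∧
      ∀ (ID : Type*) [LinearOrder ID] (solve : CoverPackLP ID → (ID → ℝ) × (ID → ℝ)),
        IsExactSolver solve → ∀ L : CoverPackLP ID, L.Vd.card ≤ n → (∃ x, L.PrimalFeasible x) →
          1 - (n : ℝ) ^ (-β) ≤ successProb solve ℓ R p (1 + ε) L := by
  have hn2 : (2 : ℝ) ≤ n := by exact_mod_cast hn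
  have hn0 : (0 : ℝ) < n := by linarith
  have hlog : 0.69 ≤ Real.log n := by
    have h1 := Real.log_two_gt_d9
    have h2 := Real.log_le_log (by norm_num) hn2
    norm_num at h1 ⊢
    linarith
  set T := Real.log n / ε with hT
  have hTε : T * ε = Real.log n := by rw [hT]; field_simp
  have hT1 : 0.69 ≤ T := by
    rw [hT, le_div_iff₀ hε]
    nlinarith
  let R : ℕ := ⌈30 * T⌉₊
  have hRlow : 30 * T ≤ R := Nat.le_ceil _
  have hRup : (R : ℝ) < 30 * T + 1 := Nat.ceil_lt_add_one (by linarith)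
  have hR1 : 1 ≤ R := by
    have : (0 : ℝ) < R := by linarith
    exact_mod_cast this
  let p : unitInterval := ⟨1 - ε / 6, by linarith, by linarith⟩
  have hq : 0 < 1 - ε / 3 := by linarith
  obtain ⟨ℓ, hℓ, hfail⟩ := exists_instances hn β (q := 1 - ε / 3) (δ := ε / 6) hq (by positivity)
  refine ⟨12 * R + 3, ℓ, R, p, ?_, hℓ, hR1, le_rfl, fun ID _ solve hs L hL hfeas => ?_⟩
  · rw [mul_div_assoc, ← hT]
    push_cast
    linarith
  refine le_trans (by linarith) (le_successProb (q := 1 - ε / 3) (δ := ε / 6) hs hfeas hL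
    hq (by positivity) (by linarith) hℓ (fun u hu => ?_) ?_)
  · by_cases hεn : 1 ≤ ε * n
    · refine le_trans ?_ (le_real_clustered hL hu)
      change 1 - ε / 3 ≤ (1 - ε / 6) * (1 - n * (1 - ε / 6) ^ R)
      have hpow : (1 - ε / 6) ^ R ≤ ((n : ℝ) ^ 5)⁻¹ := by
        calc (1 - ε / 6) ^ R ≤ Real.exp (-(ε / 6)) ^ R :=
              pow_le_pow_left₀ (by linarith) (Real.one_sub_le_exp_neg _) R
          _ = Real.exp (R * -(ε / 6)) := (Real.exp_nat_mul _ _).symm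
          _ ≤ Real.exp (-(5 * Real.log n)) := by
              refine Real.exp_le_exp.2 ?_
              rw [← hTε]
              nlinarith
          _ = ((n : ℝ) ^ 5)⁻¹ := by
              rw [Real.exp_neg, show (5 : ℝ) = (5 : ℕ) by norm_num, Real.exp_nat_mul,
                Real.exp_log hn0]
      have hsmall : n * (1 - ε / 6) ^ R ≤ ε / 6 := by
        refine (mul_le_mul_of_nonneg_left hpow hn0.le).trans ?_
        rw [← div_eq_mul_inv, div_le_iff₀ (by positivity)]
        have h8 : (2 : ℝ) ^ 3 ≤ (n : ℝ) ^ 3 := pow_le_pow_left₀ (by norm_num) hn2 3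
        calc (n : ℝ) = 1 * n * 1 := by ring
          _ ≤ (ε * n) * n * ((n : ℝ) ^ 3 / 6) := by gcongr; linarith
          _ = ε / 6 * (n : ℝ) ^ 5 := by ring
      nlinarith
    · have hcard : L.Vd.card ≤ R := by
        have h1 : (L.Vd.card : ℝ) ≤ n := by exact_mod_cast hL
        have h2 : 0.69 * (n : ℝ) ≤ T := by
          rw [hT, le_div_iff₀ hε]
          nlinarith
        have : (L.Vd.card : ℝ) ≤ R := by linarith
        exact_mod_cast this
      rw [real_clustered_of_card_le hcard hu]
      change 1 - ε / 3 ≤ 1 - ε / 6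
      linarith
  · rw [div_le_iff₀ (by apply mul_pos <;> linarith)]
    nlinarith [mul_pos hε hε, mul_pos (mul_pos hε hε) (sub_pos.2 hε1)]

end CoverPackLP

theorem mainTheorem8 :
    (∃ c C : ℝ, ∃ k₀ : ℕ, 0 < c ∧ 0 < C ∧
      ∀ β : ℝ, 0 < β → ∀ k : ℕ, k₀ ≤ k → ∀ n : ℕ, 2 ≤ n →
        ∃ (ℓ R : ℕ) (p : unitInterval), 1 ≤ ℓ ∧ 1 ≤ R ∧
          ∀ (ID : Type*) [LinearOrder ID] (solve : CoverPackLP ID → (ID → ℝ) × (ID → ℝ)),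
            CoverPackLP.IsExactSolver solve →
            CoverPackLP.RunsInRounds k (CoverPackLP.lpAlgorithm ℓ R solve) ∧
            ∀ L : CoverPackLP ID, L.Vd.card ≤ n → (∃ x, L.PrimalFeasible x) →
              1 - (n : ℝ) ^ (-β) ≤
                CoverPackLP.successProb solve ℓ R p (C * (n : ℝ) ^ (c / (k : ℝ))) L) ∧
    (∃ C : ℝ, 0 < C ∧
      ∀ β : ℝ, 0 < β → ∀ ε : ℝ, 0 < ε → ε < 1 → ∀ n : ℕ, 2 ≤ n →
        ∃ (k ℓ R : ℕ) (p : unitInterval), (k : ℝ) ≤ C * Real.log n / ε ∧ 1 ≤ ℓ ∧ 1 ≤ R ∧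
          ∀ (ID : Type*) [LinearOrder ID] (solve : CoverPackLP ID → (ID → ℝ) × (ID → ℝ)),
            CoverPackLP.IsExactSolver solve →
            CoverPackLP.RunsInRounds k (CoverPackLP.lpAlgorithm ℓ R solve) ∧
            ∀ L : CoverPackLP ID, L.Vd.card ≤ n → (∃ x, L.PrimalFeasible x) →
              1 - (n : ℝ) ^ (-β) ≤
                CoverPackLP.successProb solve ℓ R p (1 + ε) L) := by
  refine ⟨⟨60, 4, 15, by norm_num, by norm_num, fun β _ k hk n hn => ?_⟩,
    ⟨400, by norm_num, fun β _ ε hε hε1 n hn => ?_⟩⟩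
  · obtain ⟨ℓ, R, p, hℓ, hR, hRk, h⟩ := CoverPackLP.exists_parameters_few_rounds β hk hn
    exact ⟨ℓ, R, p, hℓ, hR, fun ID _ solve hs =>
      ⟨CoverPackLP.runsInRounds_lpAlgorithm solve hR hRk, h ID solve hs⟩⟩
  · obtain ⟨k, ℓ, R, p, hk, hℓ, hR, hRk, h⟩ :=
      CoverPackLP.exists_parameters_small_ratio β hε hε1 hn
    exact ⟨k, ℓ, R, p, hk, hℓ, hR, fun ID _ solve hs =>
      ⟨CoverPackLP.runsInRounds_lpAlgorithm solve hR hRk, h ID solve hs⟩⟩
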